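/- Let $R$ be a commutative ring. For a directed graph $G$ (loops allowed, no parallel edges), let $d$ be the shortest path metric on its vertices, and let $\mathrm{RC}_*(G)$ be the chain complex of $R$-modules with basis in degree $k$ the tuples $(x_0,\dots,x_k)$ of vertices with $x_{i-1}\neq x_i$ and $d(x_{i-1},x_i)<\infty$ for $1 \le i \le k$, and with differential $\partial(x_0,\dots,x_k)=\sum_{i}(-1)^i(x_0,\dots,\widehat{x_i},\dots,x_k)$, terms with repeated consecutive entries being omitted. It is filtered by length: $F_\ell\mathrm{RC}_*(G)$ is spanned by the tuples with $\sum_i d(x_{i-1},x_i)\le \ell$. Let $E^r_{*,*}(G)$ be the spectral sequence of this filtered complex; the bigraded path homology of $G$ is $\mathrm{PH}_{k,\ell}(G)=E^2_{\ell,k-\ell}(G)$. It is functorial for maps of directed graphs, i.e. maps of vertices that send each edge to an edge or collapse it to a vertex. For integers $m,n\ge 1$ let $C_{m,n}$ be the directed graph obtained from directed intervals of lengths $m$ and $n$ by identifying their initial points and identifying their final points (parallel edges being identified when $m=n=1$), and put $\mathfrak m=\max(m,n)$. \textbf{Proposition.} The bigraded path homology of $C_{m,n}$ depends only on $\mathfrak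 m$: if $m,n,m',n'\ge 1$ and $\max(m,n)=\max(m',n')$, then $\mathrm{PH}_{k,\ell}(C_{m,n})\cong \mathrm{PH}_{k,\ell}(C_{m',n'})$ as $R$-modules for all $k,\ell$. More precisely, choose the shorter of the two directed intervals of $C_{m,n}$ (either one if $m=n$) and contract all of its edges except the last, to obtain a map $C_{m,n}\to C_{\mathfrak m,1}$. This map induces an isomorphism $\mathrm{PH}_{k,\ell}(C_{m,n})\to\mathrm{PH}_{k,\ell}(C_{\mathfrak m,1})$ for all $k,\ell$. -/

import Mathlib

noncomputable section

namespace BigradedPath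

/-! ### Directed graphs, their maps, and the shortest path metric

Directed graphs are Mathlib's `Digraph`s: loops are allowed, parallel edges are not. -/

/-- A map of directed graphs: every edge is sent to an edge or collapsed to a vertex. -/
structure GraphMap {V W : Type*} (G : Digraph V) (H : Digraph W) where
  toFun : V → W
  map_adj : ∀ x y, G.Adj x y → toFun x = toFun y ∨ H.Adj (toFun x) (toFun y)

/-- `HasPath G n x y`: there is a directed path with exactly `n` edges from `x` to `y`. -/
inductive HasPath {V : Type*} (G : Digraph V) : ℕ → V → V → Prop
  | nil (x : V) : HasPath G 0 x x
  | cons {n : ℕ} {x y z : V} (h : G.Adj x y) (p : HasPath G n y z) : HasPath G (n + 1) x z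

/-- There is a directed path from `x` to `y`. -/
def Reachable {V : Type*} (G : Digraph V) (x y : V) : Prop := ∃ n, HasPath G n x y

/-- The shortest path metric, with value `⊤` when there is no path. -/
def dist {V : Type*} (G : Digraph V) (x y : V) : ℕ∞ := ⨅ (n : ℕ) (_ : HasPath G n x y), (n : ℕ∞)

/-- The length of a tuple of vertices. -/
def length {V : Type*} (G : Digraph V) {k : ℕ} (x : Fin (k + 1) → V) : ℕ∞ :=
  ∑ i : Fin k, dist G (x i.castSucc) (x i.succ)

/-! ### Reachability chains -/

/-- The tuples that form the basis of the reachability chains: consecutive entries are distinct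
and there is a directed path from each entry to the next. -/
def IsGen {V : Type*} (G : Digraph V) {k : ℕ} (x : Fin (k + 1) → V) : Prop :=
  ∀ i : Fin k, x i.castSucc ≠ x i.succ ∧ Reachable G (x i.castSucc) (x i.succ)

/-- The reachability chains in degree `k` (there are none in negative degrees). -/
abbrev RC (R : Type*) [CommRing R] {V : Type*} (G : Digraph V) (k : ℕ) : Type _ :=
  {x : Fin (k + 1) → V // IsGen G x} →₀ R

open Classical in
/-- The chain given by a tuple, with tuples that are not basis elements read as `0`. -/
def gen (R : Type*) [CommRing R] {V : Type*} (G : Digraph V) {k : ℕ} (x : Fin (k + 1) → V) :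
    RC R G k :=
  if h : IsGen G x then Finsupp.single ⟨x, h⟩ 1 else 0

/-- The differential `∂(x₀, …, xₖ) = ∑ᵢ (-1)ⁱ (x₀, …, x̂ᵢ, …, xₖ)`, where terms with repeated
consecutive entries are omitted; it goes from degree `k` to degree `k - 1` and is zero on
degree `0`. -/
def boundary (R : Type*) [CommRing R] {V : Type*} (G : Digraph V) :
    (k : ℕ) → RC R G k →ₗ[R] RC R G (k - 1)
  | 0 => 0
  | (k + 1) => Finsupp.linearCombination R fun x =>
      ∑ i : Fin (k + 2), (-1 : R) ^ (i : ℕ) • gen R G (k := k) (x.1 ∘ i.succAbove)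

/-- The length filtration `F_p RC_k`, spanned by the generators of length at most `p`; it is zero
for negative `p`. -/
def filt (R : Type*) [CommRing R] {V : Type*} (G : Digraph V) (p : ℤ) (k : ℕ) :
    Submodule R (RC R G k) :=
  Finsupp.supported R R {x | ∃ n : ℕ, length G x.1 ≤ n ∧ (n : ℤ) ≤ p}

/-! ### The magnitude-path spectral sequence

The spectral sequence of the filtered complex `RC`. We index by the filtration degree `p` and the
total degree `k`, so that `page r p k` is `E^r_{p, k - p}` in the usual bigrading. -/

/-- The approximate cycles `Z^r_p = {c ∈ F_p RC_k | ∂c ∈ F_{p-r} RC_{k-1}}`. -/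
def cyc (R : Type*) [CommRing R] {V : Type*} (G : Digraph V) (r p : ℤ) (k : ℕ) :
    Submodule R (RC R G k) :=
  filt R G p k ⊓ (filt R G (p - r) (k - 1)).comap (boundary R G k)

/-- The denominator `Z^{r-1}_{p-1} + ∂ Z^{r-1}_{p+r-1}` of the page `E^r`. -/
def bdry (R : Type*) [CommRing R] {V : Type*} (G : Digraph V) (r p : ℤ) (k : ℕ) :
    Submodule R (RC R G k) :=
  cyc R G (r - 1) (p - 1) k ⊔
    (cyc R G (r - 1) (p + r - 1) (k + 1)).map (boundary R G (k + 1) : RC R G (k + 1) →ₗ[R] RC R G k)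

/-- The quotient `Z / B` of submodules `B ≤ Z` of a module. -/
abbrev Subquot {R M : Type*} [CommRing R] [AddCommGroup M] [Module R M] (Z B : Submodule R M) :
    Type _ :=
  Z ⧸ B.submoduleOf Z

/-- The term `E^r_{p, k-p} = Z^r_p / (Z^{r-1}_{p-1} + ∂ Z^{r-1}_{p+r-1})`, for `r ≥ 0`. -/
abbrev page (R : Type*) [CommRing R] {V : Type*} (G : Digraph V) (r p : ℤ) (k : ℕ) : Type _ :=
  Subquot (cyc R G r p k) (bdry R G r p k)

/-- Bigraded path homology `PH_{k,ℓ}(G) = E^2_{ℓ,k-ℓ}(G)`. -/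
abbrev PH (R : Type*) [CommRing R] {V : Type*} (G : Digraph V) (k : ℕ) (l : ℤ) : Type _ :=
  page R G 2 l k

/-! ### Functoriality -/

theorem HasPath.trans {V : Type*} {G : Digraph V} {m n : ℕ} {x y z : V}
    (p : HasPath G m x y) (q : HasPath G n y z) : HasPath G (m + n) x z := by
  induction p with
  | nil x => simpa using q
  | cons h _ ih =>
    have := HasPath.cons h (ih q)
    rwa [show ∀ a b : ℕ, a + b + 1 = a + 1 + b by intros; omega] at this

theorem Reachable.trans {V : Type*} {G : Digraph V} {x y z : V}
    (p : Reachable G x y) (q : Reachable G y z) : Reachable G x z :=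
  ⟨_, p.choose_spec.trans q.choose_spec⟩

section Functoriality

variable {V W : Type*} {G : Digraph V} {H : Digraph W}

theorem GraphMap.hasPath (f : GraphMap G H) {n : ℕ} {x y : V} (p : HasPath G n x y) :
    ∃ m ≤ n, HasPath H m (f.toFun x) (f.toFun y) := by
  induction p with
  | nil x => exact ⟨0, le_rfl, .nil _⟩
  | cons h _ ih =>
    obtain ⟨m, hm, q⟩ := ih
    rcases f.map_adj _ _ h with e | e
    · exact ⟨m, by omega, e ▸ q⟩
    · exact ⟨m + 1, by omega, .cons e q⟩

theorem GraphMap.reachable (f : GraphMap G H) {x y : V} (p : Reachable G x y) :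
    Reachable H (f.toFun x) (f.toFun y) := by
  obtain ⟨n, p⟩ := p
  obtain ⟨m, -, q⟩ := f.hasPath p
  exact ⟨m, q⟩

theorem GraphMap.dist_le (f : GraphMap G H) (x y : V) :
    dist H (f.toFun x) (f.toFun y) ≤ dist G x y := by
  refine le_iInf₂ fun n p => ?_
  obtain ⟨m, hm, q⟩ := f.hasPath p
  exact (iInf₂_le m q).trans (by exact_mod_cast hm)

theorem GraphMap.length_le (f : GraphMap G H) {k : ℕ} (x : Fin (k + 1) → V) :
    length H (f.toFun ∘ x) ≤ length G x :=
  Finset.sum_le_sum fun _ _ => f.dist_le _ _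

variable (R : Type*) [CommRing R]

theorem gen_eq_zero {k : ℕ} {x : Fin (k + 1) → V} (i : Fin k)
    (h : x i.castSucc = x i.succ) : gen R G x = 0 := by
  rw [gen, dif_neg]
  exact fun hx => (hx i).1 h

theorem sum_faces_eq_zero {k : ℕ} {y : Fin (k + 2) → V} (a : Fin (k + 1))
    (h : y a.castSucc = y a.succ) :
    ∑ i : Fin (k + 2), (-1 : R) ^ (i : ℕ) • gen R G (k := k) (y ∘ i.succAbove) = 0 := by
  rw [Fintype.sum_eq_add a.castSucc a.succ (by simp [Fin.ext_iff])]
  · have : y ∘ a.castSucc.succAbove = y ∘ a.succ.succAbove := by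
      funext b
      simp only [Function.comp]
      rcases lt_trichotomy b a with hb | rfl | hb
      · rw [Fin.succAbove_castSucc_of_lt _ _ hb, Fin.succAbove_succ_of_le _ _ hb.le]
      · simp [h]
      · rw [Fin.succAbove_castSucc_of_le _ _ hb.le, Fin.succAbove_succ_of_lt _ _ hb]
    rw [this, ← add_smul]
    simp [pow_succ]
  · rintro i ⟨h1, h2⟩
    rcases k with _ | k
    · exfalso
      have := a.isLt; have := i.isLt
      simp only [ne_eq, Fin.ext_iff, Fin.val_castSucc, Fin.val_succ] at h1 h2
      omega
    rw [gen_eq_zero, smul_zero]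
    · simp only [ne_eq, Fin.ext_iff, Fin.val_castSucc, Fin.val_succ] at h1 h2
      have := a.isLt; have := i.isLt
      exact ⟨if (i : ℕ) < a then a - 1 else a, by split_ifs <;> omega⟩
    · simp only [ne_eq, Fin.ext_iff, Fin.val_castSucc, Fin.val_succ] at h1 h2
      have := a.isLt; have := i.isLt
      simp only [Function.comp]
      convert h using 2
      · ext
        simp only [Fin.succAbove, Fin.lt_def, Fin.castSucc_mk, Fin.succ_mk, Fin.val_castSucc]
        split_ifs <;> simp <;> omega
      · ext
        simp only [Fin.succAbove, Fin.lt_def, Fin.castSucc_mk, Fin.succ_mk, Fin.val_succ]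
        split_ifs <;> simp <;> omega

theorem boundary_gen {k : ℕ} (y : Fin (k + 2) → V)
    (hy : ∀ i : Fin (k + 1), Reachable G (y i.castSucc) (y i.succ)) :
    boundary R G (k + 1) (gen R G y) =
      ∑ i : Fin (k + 2), (-1 : R) ^ (i : ℕ) • gen R G (k := k) (y ∘ i.succAbove) := by
  by_cases h : IsGen G y
  · rw [gen, dif_pos h, boundary]
    simp
  · obtain ⟨a, ha⟩ : ∃ a : Fin (k + 1), y a.castSucc = y a.succ := by
      by_contra hc
      push Not at hc
      exact h fun i => ⟨hc i, hy i⟩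
    rw [gen, dif_neg h, map_zero, sum_faces_eq_zero R a ha]

theorem reachable_face {k : ℕ} {y : Fin (k + 2) → V}
    (hy : ∀ i : Fin (k + 1), Reachable G (y i.castSucc) (y i.succ)) (j : Fin (k + 2))
    (i : Fin k) :
    Reachable G ((y ∘ j.succAbove) i.castSucc) ((y ∘ j.succAbove) i.succ) := by
  simp only [Function.comp]
  rcases lt_trichotomy (j : ℕ) (i + 1) with h | h | h
  · rw [Fin.succAbove_of_le_castSucc _ _ (by simp [Fin.le_def]; omega),
      Fin.succAbove_of_le_castSucc _ _ (by simp [Fin.le_def]; omega)]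
    exact hy i.succ
  · rw [Fin.succAbove_of_castSucc_lt _ _ (by simp [Fin.lt_def]; omega),
      Fin.succAbove_of_le_castSucc _ _ (by simp [Fin.le_def]; omega)]
    exact (hy i.castSucc).trans (hy i.succ)
  · rw [Fin.succAbove_of_castSucc_lt _ _ (by simp [Fin.lt_def]; omega),
      Fin.succAbove_of_castSucc_lt _ _ (by simp [Fin.lt_def]; omega)]
    exact hy i.castSucc

theorem boundary_boundary (k : ℕ) (c : RC R G k) :
    boundary R G (k - 1) (boundary R G k c) = 0 := by
  rcases k with _ | _ | k
  · simp [boundary]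
  · simp [boundary]
  induction c using Finsupp.induction_linear with
  | zero => simp
  | add a b ha hb => simp only [map_add, ha, hb, add_zero]
  | single x a =>
    have hx : ∀ i, Reachable G (x.1 (Fin.castSucc i)) (x.1 i.succ) := fun i => (x.2 i).2
    have e : (Finsupp.single x a : RC R G (k + 2)) = a • gen R G x.1 := by
      rw [gen, dif_pos x.2]; simp
    rw [e, map_smul, boundary_gen R _ hx, map_smul]
    change a • boundary R G (k + 1) _ = 0
    rw [map_sum]
    simp_rw [map_smul, boundary_gen R _ (reachable_face hx _), Finset.smul_sum, smul_smul,
      ← pow_add]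
    rw [← Finset.sum_product', Finset.univ_product_univ]
    refine Finset.sum_involution
      (fun (ij : Fin (k + 3) × Fin (k + 2)) _ => (ij.1.succAbove ij.2, ij.2.predAbove ij.1)) ?_ ?_ ?_ ?_
    · rintro ⟨i, j⟩ -
      have h1 : (x.1 ∘ i.succAbove) ∘ j.succAbove =
          (x.1 ∘ (i.succAbove j).succAbove) ∘ (j.predAbove i).succAbove := by
        funext b
        simp only [Function.comp]
        rw [Fin.succAbove_succAbove_succAbove_predAbove]
      have h2 := Fin.neg_one_pow_succAbove_add_predAbove (R := R) i j
      simp only [h1, h2]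
      rw [← add_smul]
      simp
    · rintro ⟨i, j⟩ - - h
      exact Fin.succAbove_ne i j (congrArg Prod.fst h)
    · simp
    · rintro ⟨i, j⟩ -
      exact Prod.ext (Fin.succAbove_succAbove_predAbove i j)
        (Fin.predAbove_predAbove_succAbove i j)

theorem filt_mono {p q : ℤ} (h : p ≤ q) (k : ℕ) : filt R G p k ≤ filt R G q k :=
  Finsupp.supported_mono fun _ ⟨n, hn, hp⟩ => ⟨n, hn, hp.trans h⟩

theorem bdry_le_cyc (r p : ℤ) (k : ℕ) : bdry R G r p k ≤ cyc R G r p k := by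
  refine sup_le (fun c hc => ⟨filt_mono R (by omega) k hc.1, ?_⟩) ?_
  · exact filt_mono R (by omega) (k - 1) hc.2
  · rintro _ ⟨b, hb, rfl⟩
    refine ⟨filt_mono R (by omega) k hb.2, ?_⟩
    have h0 : boundary R G k (boundary R G (k + 1) b) = 0 := boundary_boundary R (k + 1) b
    change boundary R G k (boundary R G (k + 1) b) ∈ filt R G (p - r) (k - 1)
    rw [h0]
    exact Submodule.zero_mem _

/-- The chain map induced by a map of directed graphs:
`(x₀, …, xₖ) ↦ (f x₀, …, f xₖ)`, read as `0` if this tuple has repeated consecutive entries. -/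
def RCmap (f : GraphMap G H) (k : ℕ) : RC R G k →ₗ[R] RC R H k :=
  Finsupp.linearCombination R fun x => gen R H (f.toFun ∘ x.1)

theorem RCmap_gen (f : GraphMap G H) {k : ℕ} (y : Fin (k + 1) → V)
    (hy : ∀ i : Fin k, Reachable G (y i.castSucc) (y i.succ)) :
    RCmap R f k (gen R G y) = gen R H (f.toFun ∘ y) := by
  by_cases h : IsGen G y
  · rw [gen, dif_pos h, RCmap]
    simp
  · obtain ⟨a, ha⟩ : ∃ a : Fin k, y a.castSucc = y a.succ := by
      by_contra hc
      push Not at hc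
      exact h fun i => ⟨hc i, hy i⟩
    rw [gen, dif_neg h, map_zero, gen_eq_zero R a (by simp [ha])]

theorem boundary_RCmap (f : GraphMap G H) (k : ℕ) (c : RC R G k) :
    boundary R H k (RCmap R f k c) = RCmap R f (k - 1) (boundary R G k c) := by
  cases k with
  | zero => simp [boundary]
  | succ k =>
    induction c using Finsupp.induction_linear with
    | zero => simp
    | add a b ha hb => simp only [map_add, ha, hb]
    | single x a =>
      have hx : ∀ i : Fin (k + 1), Reachable G (x.1 i.castSucc) (x.1 i.succ) := fun i => (x.2 i).2
      have e : (Finsupp.single x a : RC R G (k + 1)) = a • gen R G x.1 := by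
        rw [gen, dif_pos x.2]; simp
      rw [e, map_smul, map_smul, map_smul, map_smul, RCmap_gen R f _ hx, boundary_gen R _ hx,
        boundary_gen R _ (fun i => f.reachable (hx i))]
      congr 1
      change _ = RCmap R f k _
      rw [map_sum]
      refine Finset.sum_congr rfl fun i _ => ?_
      rw [map_smul, RCmap_gen R f _ (reachable_face hx i)]
      rfl

theorem RCmap_mem_filt (f : GraphMap G H) {p : ℤ} {k : ℕ} {c : RC R G k}
    (hc : c ∈ filt R G p k) : RCmap R f k c ∈ filt R H p k := by
  rw [RCmap, Finsupp.linearCombination_apply]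
  refine Submodule.sum_mem _ fun x hx => Submodule.smul_mem _ _ ?_
  obtain ⟨n, hn, hp⟩ := (Finsupp.mem_supported R c).1 hc hx
  rw [gen]
  split_ifs
  · exact Finsupp.single_mem_supported R _ ⟨n, (f.length_le x.1).trans hn, hp⟩
  · exact Submodule.zero_mem _

theorem RCmap_mem_cyc (f : GraphMap G H) {r p : ℤ} {k : ℕ} {c : RC R G k}
    (hc : c ∈ cyc R G r p k) : RCmap R f k c ∈ cyc R H r p k := by
  refine ⟨RCmap_mem_filt R f hc.1, ?_⟩
  change boundary R H k (RCmap R f k c) ∈ filt R H (p - r) (k - 1)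
  rw [boundary_RCmap]
  exact RCmap_mem_filt R f hc.2

theorem RCmap_mem_bdry (f : GraphMap G H) {r p : ℤ} {k : ℕ} {c : RC R G k}
    (hc : c ∈ bdry R G r p k) : RCmap R f k c ∈ bdry R H r p k := by
  obtain ⟨a, ha, b, ⟨b', hb', rfl⟩, rfl⟩ := Submodule.mem_sup.1 hc
  rw [map_add]
  refine Submodule.add_mem_sup (RCmap_mem_cyc R f ha)
    ⟨RCmap R f (k + 1) b', RCmap_mem_cyc R f hb', boundary_RCmap R f (k + 1) b'⟩

/-- The map induced on the page `E^r` by a map of directed graphs. -/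
def pageMap (f : GraphMap G H) (r p : ℤ) (k : ℕ) : page R G r p k →ₗ[R] page R H r p k :=
  Submodule.mapQ _ _ ((RCmap R f k).restrict fun _ hc => RCmap_mem_cyc R f hc)
    fun _ hc => RCmap_mem_bdry R f hc

/-- The map induced on bigraded path homology by a map of directed graphs. -/
def PHmap (f : GraphMap G H) (k : ℕ) (l : ℤ) : PH R G k l →ₗ[R] PH R H k l :=
  pageMap R f 2 l k

end Functoriality

/-! ### Bi-directed cycles -/

/-- The vertices of `C_{m,n}`: `inl i` is the `i`-th vertex of the interval of length `m`
(`0 ≤ i ≤ m`), including the shared initial vertex `inl 0` and the shared terminal vertex `inl m`;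
`inr j` is the `(j+1)`-st vertex of the interval of length `n`, for the interior vertices
`1 ≤ j + 1 ≤ n - 1`. -/
abbrev CycleVertex (m n : ℕ) : Type := Fin (m + 1) ⊕ Fin (n - 1)

/-- The `i`-th vertex of the interval of length `m` in `C_{m,n}`. -/
def topVertex (m n : ℕ) (i : Fin (m + 1)) : CycleVertex m n := Sum.inl i

/-- The `j`-th vertex of the interval of length `n` in `C_{m,n}`; its ends are the ends of the
interval of length `m`. -/
def botVertex (m n : ℕ) (j : Fin (n + 1)) : CycleVertex m n :=
  if h0 : (j : ℕ) = 0 then Sum.inl 0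
  else if hn : (j : ℕ) = n then Sum.inl (Fin.last m)
  else Sum.inr ⟨j - 1, by omega⟩

/-- The bi-directed cycle `C_{m,n}`, for `m, n ≥ 1`: directed intervals of lengths `m` and `n` with
their initial points identified and their final points identified. -/
def C (m n : ℕ) : Digraph (CycleVertex m n) where
  Adj x y :=
    (∃ i : Fin m, x = topVertex m n i.castSucc ∧ y = topVertex m n i.succ) ∨
    (∃ j : Fin n, x = botVertex m n j.castSucc ∧ y = botVertex m n j.succ)

/-- The map `C_{m,n} → C_{m,1}` contracting all edges of the interval of length `n` except the
last one. -/
def contractBot (m n : ℕ) : GraphMap (C m n) (C m 1) where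
  toFun := Sum.elim (fun i => topVertex m 1 i) (fun _ => topVertex m 1 0)
  map_adj := by
    rintro x y (⟨i, rfl, rfl⟩ | ⟨j, rfl, rfl⟩)
    · exact Or.inr (Or.inl ⟨i, rfl, rfl⟩)
    · by_cases hj : (j : ℕ) + 1 = n
      · right; right
        refine ⟨0, ?_, ?_⟩
        · by_cases h0 : (j : ℕ) = 0
          · simp [botVertex, topVertex, h0]
          · have : (j : ℕ) ≠ n := by omega
            simp [botVertex, topVertex, h0, this]
        · have h0 : n ≠ 0 := by omega
          simp [botVertex, topVertex, hj, h0]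
      · left
        have h1 : (j : ℕ) ≠ n := by omega
        by_cases h0 : (j : ℕ) = 0 <;> simp_all [botVertex, topVertex]

/-- The map `C_{m,n} → C_{n,1}` contracting all edges of the interval of length `m` except the
last one; the interval of length `n` becomes the one of length `n` in `C_{n,1}`. -/
def contractTop (m n : ℕ) (hm : 1 ≤ m) : GraphMap (C m n) (C n 1) where
  toFun := Sum.elim (fun i => if i = Fin.last m then topVertex n 1 (Fin.last n) else topVertex n 1 0)
    (fun j => topVertex n 1 ⟨j + 1, by omega⟩)
  map_adj := by
    have key : ∀ j : Fin (n + 1), Sum.elim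
        (fun i => if i = Fin.last m then topVertex n 1 (Fin.last n) else topVertex n 1 0)
        (fun j : Fin (n - 1) => topVertex n 1 ⟨j + 1, by omega⟩) (botVertex m n j) =
          topVertex n 1 j := by
      intro j
      have hm' : (0 : Fin (m + 1)) ≠ Fin.last m := by
        simp only [ne_eq, Fin.ext_iff, Fin.val_zero, Fin.val_last]; omega
      unfold botVertex
      split_ifs with h0 hn
      · rw [Sum.elim_inl, if_neg hm']
        simp [topVertex, Fin.ext_iff, h0]
      · simp [topVertex, Fin.ext_iff, hn]
      · simp only [Sum.elim_inr, topVertex, Sum.inl.injEq, Fin.ext_iff]; omega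
    rintro x y (⟨i, rfl, rfl⟩ | ⟨j, rfl, rfl⟩)
    · have h1 : i.castSucc ≠ Fin.last m := by
        simp only [ne_eq, Fin.ext_iff, Fin.val_castSucc, Fin.val_last]; omega
      by_cases h2 : i.succ = Fin.last m
      · right; right
        exact ⟨0, by simp [topVertex, botVertex, h1], by simp [topVertex, botVertex, h2]⟩
      · left
        simp [topVertex, h1, h2]
    · right; left
      exact ⟨j, key _, key _⟩

end BigradedPath

end

/-! Let `f` collapse the shorter interval, the spine `b 0, b 1, …, top`, onto a single edge. On
reachability chains `f` is surjective, but lifting tuples vertex by vertex does not respect length: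
the pair `(b 0, top)` has length `1` in the target and the length of the spine in the source. The
cure is to lift this pair to the sum of the edges of the spine, a chain with the same boundary and
filtration `1`. A homotopy `h` makes this precise: if the first two entries of a tuple lie on the
spine, `h` replaces the first entry by the edges of the spine joining the two. It raises length by
at most one, `f` kills it, and `1 - (∂h + h∂)` factors through `f` (`deform_gen_retract`) by a map
that preserves length (`deform_sec_mem_filt`). So `f` has a filtered section `s` with `f s = 1` and
`1 - s f = ∂h + h∂`. A homotopy that raises the filtration by one induces zero on `E²`, hence `f` is
an isomorphism there (`PHmap_bijective_of_homotopy`). That the spine is the shorter interval enters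
twice: it must be a geodesic, and the correction terms of the section trade a route along the long
interval for one along the spine. When the first interval is the shorter one, the two intervals are
interchanged. -/

noncomputable section

namespace BigradedPath

variable {V W : Type*} {G : Digraph V} {H : Digraph W}
variable (R : Type*) [CommRing R]

/-! ### A criterion for isomorphisms on the second page -/

section Criterion

/-- The differential out of a positive degree. -/
def bd (G : Digraph V) (k : ℕ) : RC R G (k + 1) →ₗ[R] RC R G k := boundary R G (k + 1)

variable {R}

theorem bd_bd (k : ℕ) (c : RC R G (k + 2)) : bd R G k (bd R G (k + 1) c) = 0 :=
  boundary_boundary R (k + 2) c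

theorem bd_RCmap (f : GraphMap G H) (k : ℕ) (c : RC R G (k + 1)) :
    bd R H k (RCmap R f (k + 1) c) = RCmap R f k (bd R G k c) :=
  boundary_RCmap R f (k + 1) c

/-- Truncated subtraction sends degree `0` to degree `0`, and the differential there is zero. -/
theorem mem_cyc_zero {r p : ℤ} {c : RC R G 0} : c ∈ cyc R G r p 0 ↔ c ∈ filt R G p 0 :=
  ⟨fun h => h.1, fun h => ⟨h, (filt R G (p - r) 0).zero_mem⟩⟩

theorem mem_cyc_succ {r p : ℤ} {k : ℕ} {c : RC R G (k + 1)} :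
    c ∈ cyc R G r p (k + 1) ↔ c ∈ filt R G p (k + 1) ∧ bd R G k c ∈ filt R G (p - r) k :=
  Iff.rfl

theorem mem_bdry {r p : ℤ} {k : ℕ} {c : RC R G k} :
    c ∈ bdry R G r p k ↔ ∃ a ∈ cyc R G (r - 1) (p - 1) k,
      ∃ b ∈ cyc R G (r - 1) (p + r - 1) (k + 1), a + bd R G k b = c := by
  constructor
  · intro h
    obtain ⟨a, ha, _, ⟨b, hb, rfl⟩, hab⟩ := Submodule.mem_sup.1 h
    exact ⟨a, ha, b, hb, hab⟩
  · rintro ⟨a, ha, b, hb, rfl⟩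
    exact Submodule.add_mem_sup ha ⟨b, hb, rfl⟩

/-- The chain map `1 - (∂h + h∂)` attached to a family of maps raising the degree by one. -/
def deform (h : ∀ k, RC R G k →ₗ[R] RC R G (k + 1)) : ∀ k, RC R G k →ₗ[R] RC R G k
  | 0 => LinearMap.id - bd R G 0 ∘ₗ h 0
  | (k + 1) => LinearMap.id - bd R G (k + 1) ∘ₗ h (k + 1) - h k ∘ₗ bd R G k

theorem deform_zero_apply (h : ∀ k, RC R G k →ₗ[R] RC R G (k + 1)) (c : RC R G 0) :
    deform h 0 c = c - bd R G 0 (h 0 c) := rfl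

theorem deform_succ_apply (h : ∀ k, RC R G k →ₗ[R] RC R G (k + 1)) (k : ℕ) (c : RC R G (k + 1)) :
    deform h (k + 1) c = c - bd R G (k + 1) (h (k + 1) c) - h k (bd R G k c) := rfl

theorem bd_deform (h : ∀ k, RC R G k →ₗ[R] RC R G (k + 1)) (k : ℕ) (c : RC R G (k + 1)) :
    bd R G k (deform h (k + 1) c) = deform h k (bd R G k c) := by
  rw [deform_succ_apply, map_sub, map_sub, bd_bd, sub_zero]
  cases k with
  | zero => rw [deform_zero_apply]
  | succ k => rw [deform_succ_apply, bd_bd, map_zero, sub_zero]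

theorem RCmap_deform (f : GraphMap G H) (h : ∀ k, RC R G k →ₗ[R] RC R G (k + 1))
    (hf : ∀ k c, RCmap R f (k + 1) (h k c) = 0) (k : ℕ) (c : RC R G k) :
    RCmap R f k (deform h k c) = RCmap R f k c := by
  cases k with
  | zero => rw [deform_zero_apply, map_sub, ← bd_RCmap, hf, map_zero, sub_zero]
  | succ k =>
    rw [deform_succ_apply, map_sub, map_sub, ← bd_RCmap, hf, hf, map_zero, sub_zero, sub_zero]

theorem filt_neg_eq_zero {p : ℤ} (hp : p < 0) {k : ℕ} {c : RC R G k} (hc : c ∈ filt R G p k) :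
    c = 0 := by
  rw [filt, Finsupp.mem_supported] at hc
  rw [← Finsupp.support_eq_empty, ← Finset.coe_eq_empty, Set.eq_empty_iff_forall_notMem]
  intro x hx
  obtain ⟨n, -, hn⟩ := hc hx
  omega

/-- The deformation of an arbitrary lift is still a lift, since `f` kills `h`. Its filtration, and
that of its boundary, are controlled downstairs because the deformation is a chain map. -/
theorem exists_cyc_lift (f : GraphMap G H) (h : ∀ k, RC R G k →ₗ[R] RC R G (k + 1))
    (hf : ∀ k c, RCmap R f (k + 1) (h k c) = 0)
    (hs : ∀ k, Function.Surjective (RCmap R f k))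
    (hd : ∀ k p c, RCmap R f k c ∈ filt R H p k → deform h k c ∈ filt R G p k)
    {r p : ℤ} {k : ℕ} {d : RC R H k} (hdc : d ∈ cyc R H r p k) :
    ∃ c ∈ cyc R G r p k, RCmap R f k c = d := by
  obtain ⟨c, rfl⟩ := hs k d
  refine ⟨deform h k c, ?_, RCmap_deform f h hf k c⟩
  cases k with
  | zero => exact mem_cyc_zero.2 (hd _ _ _ hdc.1)
  | succ k =>
    refine mem_cyc_succ.2 ⟨hd _ _ _ hdc.1, ?_⟩
    rw [bd_deform]
    refine hd _ _ _ ?_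
    rw [← bd_RCmap]
    exact hdc.2

/-- Here `c = ∂hc + h∂c`. The boundary drops by two and `h` climbs by at most one, so `h∂c` has
filtration `p - 1` and `hc` has filtration `p + 1`: the two summands in the denominator of `E²`. -/
theorem mem_bdry_two_of_deform_eq_zero (h : ∀ k, RC R G k →ₗ[R] RC R G (k + 1))
    (hh : ∀ k p c, c ∈ filt R G p k → h k c ∈ filt R G (p + 1) (k + 1))
    {p : ℤ} {k : ℕ} {c : RC R G k} (hc : c ∈ cyc R G 2 p k) (h0 : deform h k c = 0) :
    c ∈ bdry R G 2 p k := by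
  have e1 : h k c ∈ filt R G (p + 2 - 1) (k + 1) := by
    have := hh k p c hc.1
    rwa [show p + 2 - 1 = p + 1 by ring]
  cases k with
  | zero =>
    have e : c = bd R G 0 (h 0 c) := by rwa [deform_zero_apply, sub_eq_zero] at h0
    refine mem_bdry.2 ⟨0, Submodule.zero_mem _, h 0 c, mem_cyc_succ.2 ⟨e1, ?_⟩, ?_⟩
    · rw [← e]
      exact filt_mono R (by omega) _ hc.1
    · rw [zero_add, ← e]
  | succ k =>
    have e : c = bd R G (k + 1) (h (k + 1) c) + h k (bd R G k c) := by
      rwa [deform_succ_apply, sub_sub, sub_eq_zero] at h0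
    have e2 : h k (bd R G k c) ∈ filt R G (p - 1) (k + 1) := by
      have := hh k (p - 2) (bd R G k c) hc.2
      rwa [show p - 2 + 1 = p - 1 by ring] at this
    have e3 : bd R G (k + 1) (h (k + 1) c) = c - h k (bd R G k c) := eq_sub_of_add_eq e.symm
    have e4 : bd R G k (h k (bd R G k c)) = bd R G k c := by
      have h2 := bd_bd k (h (k + 1) c)
      rw [e3, map_sub, sub_eq_zero] at h2
      exact h2.symm
    refine mem_bdry.2 ⟨h k (bd R G k c), mem_cyc_succ.2 ⟨e2, ?_⟩, h (k + 1) c,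
      mem_cyc_succ.2 ⟨e1, ?_⟩, ?_⟩
    · rw [e4]
      exact filt_mono R (by omega) _ hc.2
    · rw [e3]
      exact Submodule.sub_mem _ (filt_mono R (by omega) _ hc.1) (filt_mono R (by omega) _ e2)
    · exact (add_comm _ _).trans e.symm

theorem page_mk_eq_zero {r p : ℤ} {k : ℕ} (c : cyc R G r p k) :
    (Submodule.Quotient.mk c : page R G r p k) = 0 ↔ (c : RC R G k) ∈ bdry R G r p k := by
  rw [Submodule.Quotient.mk_eq_zero]
  rfl

theorem PHmap_mk (f : GraphMap G H) {k : ℕ} {l : ℤ} (c : cyc R G 2 l k) :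
    PHmap R f k l (Submodule.Quotient.mk c) =
      Submodule.Quotient.mk ⟨RCmap R f k c, RCmap_mem_cyc R f c.2⟩ := rfl

/-- A map of directed graphs that is surjective on reachability chains induces isomorphisms on
`E²` as soon as there is a homotopy raising the filtration by at most one, killed by the map, whose
deformation `1 - (∂h + h∂)` is controlled by the map. -/
theorem PHmap_bijective_of_homotopy (f : GraphMap G H) (h : ∀ k, RC R G k →ₗ[R] RC R G (k + 1))
    (hh : ∀ k p c, c ∈ filt R G p k → h k c ∈ filt R G (p + 1) (k + 1))
    (hf : ∀ k c, RCmap R f (k + 1) (h k c) = 0)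
    (hs : ∀ k, Function.Surjective (RCmap R f k))
    (hd : ∀ k p c, RCmap R f k c ∈ filt R H p k → deform h k c ∈ filt R G p k)
    (k : ℕ) (l : ℤ) : Function.Bijective (PHmap R f k l) := by
  constructor
  · rw [← LinearMap.ker_eq_bot, LinearMap.ker_eq_bot']
    intro x hx
    obtain ⟨⟨c, hc⟩, rfl⟩ := Submodule.Quotient.mk_surjective _ x
    rw [PHmap_mk, page_mk_eq_zero] at hx
    rw [page_mk_eq_zero]
    obtain ⟨a, ha, b, hb, hab⟩ := mem_bdry.1 hx
    obtain ⟨a, ha', rfl⟩ := exists_cyc_lift f h hf hs hd ha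
    obtain ⟨b, hb', rfl⟩ := exists_cyc_lift f h hf hs hd hb
    change _ = RCmap R f k c at hab
    have hm : a + bd R G k b ∈ bdry R G 2 l k := mem_bdry.2 ⟨a, ha', b, hb', rfl⟩
    have hz : RCmap R f k (c - (a + bd R G k b)) = 0 := by
      rw [map_sub, map_add, ← hab, bd_RCmap, sub_self]
    have h0 : deform h k (c - (a + bd R G k b)) = 0 := by
      -- The image `0` lies in every filtration step, also in a negative one, and there only `0` has
      -- its deformation.
      refine filt_neg_eq_zero (p := -1) (by norm_num) (hd _ _ _ ?_)
      rw [hz]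
      exact Submodule.zero_mem _
    have := mem_bdry_two_of_deform_eq_zero h hh
      (Submodule.sub_mem _ hc (bdry_le_cyc R _ _ _ hm)) h0
    simpa using Submodule.add_mem _ this hm
  · intro y
    obtain ⟨⟨d, hdc⟩, rfl⟩ := Submodule.Quotient.mk_surjective _ y
    obtain ⟨c, hc, rfl⟩ := exists_cyc_lift f h hf hs hd hdc
    exact ⟨Submodule.Quotient.mk ⟨c, hc⟩, rfl⟩

end Criterion

/-! ### Composites -/

theorem RCmap_RCmap {U : Type*} {K : Digraph U} (f : GraphMap G H) (g : GraphMap H K)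
    (e : GraphMap G K) (he : ∀ x, e.toFun x = g.toFun (f.toFun x)) (k : ℕ) (c : RC R G k) :
    RCmap R e k c = RCmap R g k (RCmap R f k c) := by
  induction c using Finsupp.induction_linear with
  | zero => simp
  | add a b ha hb => simp only [map_add, ha, hb]
  | single x a =>
    have e1 : RCmap R f k (Finsupp.single x a) = a • gen R H (f.toFun ∘ x.1) := by simp [RCmap]
    rw [e1, map_smul, RCmap_gen R g _ fun i => f.reachable (x.2 i).2]
    have : e.toFun ∘ x.1 = g.toFun ∘ f.toFun ∘ x.1 := funext fun i => he _
    simp [RCmap, this]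

theorem RCmap_of_id (f : GraphMap G G) (hf : ∀ x, f.toFun x = x) (k : ℕ) (c : RC R G k) :
    RCmap R f k c = c := by
  induction c using Finsupp.induction_linear with
  | zero => simp
  | add a b ha hb => simp only [map_add, ha, hb]
  | single x a =>
    have : f.toFun ∘ x.1 = x.1 := funext fun i => hf _
    simp [RCmap, this, gen, x.2]

theorem PHmap_PHmap {U : Type*} {K : Digraph U} (f : GraphMap G H) (g : GraphMap H K)
    (e : GraphMap G K) (he : ∀ x, e.toFun x = g.toFun (f.toFun x)) (k : ℕ) (l : ℤ)
    (c : PH R G k l) : PHmap R e k l c = PHmap R g k l (PHmap R f k l c) := by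
  obtain ⟨c, rfl⟩ := Submodule.Quotient.mk_surjective _ c
  exact congrArg Submodule.Quotient.mk (Subtype.ext (RCmap_RCmap R f g e he k c))

theorem PHmap_of_id (f : GraphMap G G) (hf : ∀ x, f.toFun x = x) (k : ℕ) (l : ℤ)
    (c : PH R G k l) : PHmap R f k l c = c := by
  obtain ⟨c, rfl⟩ := Submodule.Quotient.mk_surjective _ c
  exact congrArg Submodule.Quotient.mk (Subtype.ext (RCmap_of_id R f hf k c))

theorem PHmap_bijective_of_inverse (f : GraphMap G H) (g : GraphMap H G)
    (hgf : ∀ x, g.toFun (f.toFun x) = x) (hfg : ∀ y, f.toFun (g.toFun y) = y) (k : ℕ) (l : ℤ) :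
    Function.Bijective (PHmap R f k l) := by
  let i : GraphMap G G := ⟨id, fun _ _ h => Or.inr h⟩
  let j : GraphMap H H := ⟨id, fun _ _ h => Or.inr h⟩
  refine Function.bijective_iff_has_inverse.2 ⟨PHmap R g k l, fun c => ?_, fun c => ?_⟩
  · rw [← PHmap_PHmap R f g i fun x => (hgf x).symm, PHmap_of_id R i fun _ => rfl]
  · rw [← PHmap_PHmap R g f j fun x => (hfg x).symm, PHmap_of_id R j fun _ => rfl]

/-! ### Tuples built by adjoining an initial entry -/

theorem cons_comp_succAbove_zero {k : ℕ} (s : V) (y : Fin (k + 1) → V) :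
    (Fin.cons s y : Fin (k + 2) → V) ∘ (0 : Fin (k + 2)).succAbove = y := by
  funext i
  simp

theorem cons_comp_succAbove_succ {k : ℕ} (s : V) (y : Fin (k + 1) → V) (i : Fin (k + 1)) :
    (Fin.cons s y : Fin (k + 2) → V) ∘ i.succ.succAbove =
      (Fin.cons s (y ∘ i.succAbove) : Fin (k + 1) → V) := by
  funext j
  refine Fin.cases ?_ (fun j => ?_) j <;> simp

/-- Each entry of the tuple can be reached from the preceding one. -/
def IsWalk (G : Digraph V) {k : ℕ} (x : Fin (k + 1) → V) : Prop :=
  ∀ i : Fin k, Reachable G (x i.castSucc) (x i.succ)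

theorem isWalk_cons {k : ℕ} {s : V} {y : Fin (k + 1) → V} :
    IsWalk G (Fin.cons s y : Fin (k + 2) → V) ↔ Reachable G s (y 0) ∧ IsWalk G y := by
  constructor
  · intro h
    exact ⟨h 0, fun i => h i.succ⟩
  · rintro ⟨h0, h⟩ i
    refine Fin.cases h0 (fun i => ?_) i
    exact h i

theorem length_cons {k : ℕ} (s : V) (y : Fin (k + 1) → V) :
    length G (Fin.cons s y : Fin (k + 2) → V) = dist G s (y 0) + length G y := by
  rw [length, Fin.sum_univ_succ]
  rfl

theorem gen_cons_self {k : ℕ} (y : Fin (k + 1) → V) :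
    gen R G (Fin.cons (y 0) y : Fin (k + 2) → V) = 0 :=
  gen_eq_zero R 0 rfl

theorem gen_cons_cons_self {k : ℕ} (s : V) (z : Fin k → V) :
    gen R G (Fin.cons s (Fin.cons s z : Fin (k + 1) → V) : Fin (k + 2) → V) = 0 :=
  gen_eq_zero R 0 rfl

theorem gen_mem_filt {k : ℕ} {x : Fin (k + 1) → V} {p : ℤ}
    (h : ∃ n : ℕ, length G x ≤ n ∧ (n : ℤ) ≤ p) : gen R G x ∈ filt R G p k := by
  rw [gen]
  split_ifs
  · exact Finsupp.single_mem_supported R _ h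
  · exact Submodule.zero_mem _

theorem boundary_gen_cons {k : ℕ} (s : V) (y : Fin (k + 1) → V)
    (h : IsWalk G (Fin.cons s y : Fin (k + 2) → V)) :
    bd R G k (gen R G (Fin.cons s y : Fin (k + 2) → V)) =
      gen R G y - ∑ i : Fin (k + 1), (-1 : R) ^ (i : ℕ) •
        gen R G (Fin.cons s (y ∘ i.succAbove) : Fin (k + 1) → V) := by
  rw [bd, boundary_gen R _ h, Fin.sum_univ_succ, cons_comp_succAbove_zero, sub_eq_add_neg,
    ← Finset.sum_neg_distrib]
  simp only [cons_comp_succAbove_succ, Fin.val_zero, pow_zero, one_smul, Fin.val_succ, pow_succ,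
    mul_neg, mul_one, neg_smul]

/-- Two entries in front shift the face index by two, so the signs of the remaining faces do not
change. -/
theorem boundary_gen_cons_cons {k : ℕ} (s s' : V) (y : Fin (k + 1) → V)
    (h : IsWalk G (Fin.cons s (Fin.cons s' y : Fin (k + 2) → V) : Fin (k + 3) → V)) :
    bd R G (k + 1) (gen R G (Fin.cons s (Fin.cons s' y : Fin (k + 2) → V) : Fin (k + 3) → V)) =
      gen R G (Fin.cons s' y : Fin (k + 2) → V) - gen R G (Fin.cons s y : Fin (k + 2) → V) +
        ∑ i : Fin (k + 1), (-1 : R) ^ (i : ℕ) •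
          gen R G (Fin.cons s (Fin.cons s' (y ∘ i.succAbove) : Fin (k + 1) → V) :
            Fin (k + 2) → V) := by
  rw [boundary_gen_cons R s _ h, Fin.sum_univ_succ, cons_comp_succAbove_zero, ← sub_sub,
    sub_eq_add_neg (_ - _), ← Finset.sum_neg_distrib]
  simp only [cons_comp_succAbove_succ, Fin.val_zero, pow_zero, one_smul, Fin.val_succ, pow_succ,
    mul_neg, mul_one, neg_smul, neg_neg]

theorem boundary_gen_pair (u v : V) (h : Reachable G u v) :
    bd R G 0 (gen R G ![u, v]) = gen R G ![v] - gen R G ![u] := by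
  have e := boundary_gen_cons R u ![v] (isWalk_cons.2 ⟨h, fun i => i.elim0⟩)
  refine e.trans ?_
  congr 1
  rw [Fin.sum_univ_one, Fin.val_zero, pow_zero, one_smul]
  congr 1

theorem IsWalk.reachable_zero {k : ℕ} {x : Fin (k + 1) → V} (h : IsWalk G x) (i : Fin (k + 1)) :
    Reachable G (x 0) (x i) := by
  induction i using Fin.induction with
  | zero => exact ⟨0, .nil _⟩
  | succ i ih => exact ih.trans (h i)

theorem IsGen.isWalk {k : ℕ} {x : Fin (k + 1) → V} (h : IsGen G x) : IsWalk G x :=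
  fun i => (h i).2

theorem exists_eq_of_not_isGen {k : ℕ} {x : Fin (k + 1) → V} (hx : IsWalk G x) (h : ¬ IsGen G x) :
    ∃ i : Fin k, x i.castSucc = x i.succ := by
  by_contra! hc
  exact h fun i => ⟨hc i, hx i⟩

/-! ### Spines -/

/-- A geodesic `b 0, b 1, …` in a directed graph that ends in a terminal vertex `top`, and
that can be entered or left only at its ends. -/
structure Spine (G : Digraph V) where
  b : ℕ → V
  pos : V → ℕ
  mem : Set V
  top : V
  b_pos : ∀ v ∈ mem, b (pos v) = v
  b_mem : ∀ t ≤ pos top, b t ∈ mem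
  pos_b : ∀ t ≤ pos top, pos (b t) = t
  b_zero_ne_top : b 0 ≠ top
  top_mem : top ∈ mem
  reachable_b : ∀ i j, i ≤ j → Reachable G (b i) (b j)
  dist_b_le : ∀ i j, i ≤ j → dist G (b i) (b j) ≤ (j - i : ℕ)
  -- Together with `dist_b_le` this makes the spine a geodesic: no route around it is shorter.
  le_dist : ∀ u ∈ mem, ∀ v ∈ mem, ((pos v - pos u : ℕ) : ℕ∞) ≤ dist G u v
  pos_lt_pos_top : ∀ v ∈ mem, v ≠ top → pos v < pos top
  pos_le : ∀ u ∈ mem, ∀ v ∈ mem, Reachable G u v → pos u ≤ pos v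
  mem_of_reachable : ∀ u, ∀ v ∈ mem, v ≠ top → Reachable G u v → u ∈ mem
  eq_of_reachable : ∀ u ∈ mem, ∀ v ∉ mem, Reachable G u v → u = b 0
  top_reachable : ∀ v, Reachable G top v → v = top

namespace Spine

variable (S : Spine G)

theorem b_zero_mem : S.b 0 ∈ S.mem := S.b_mem 0 (Nat.zero_le _)

theorem pos_b_zero : S.pos (S.b 0) = 0 := S.pos_b 0 (Nat.zero_le _)

open Classical in
/-- The sum of the tuples `(b t, b (t + 1), z)` over the edges of the spine from `u` to `v`. -/
def path (u v : V) {k : ℕ} (z : Fin k → V) : RC R G (k + 1) :=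
  if u ∈ S.mem ∧ v ∈ S.mem then
    ∑ t ∈ Finset.Ico (S.pos u) (S.pos v),
      gen R G (Fin.cons (S.b t) (Fin.cons (S.b (t + 1)) z : Fin (k + 1) → V) : Fin (k + 2) → V)
  else 0

variable {S}

theorem dist_b_succ (i : ℕ) : dist G (S.b i) (S.b (i + 1)) ≤ 1 := by
  simpa using S.dist_b_le i (i + 1) i.le_succ

theorem path_of_mem {u v : V} (hu : u ∈ S.mem) (hv : v ∈ S.mem) {k : ℕ} (z : Fin k → V) :
    S.path R u v z = ∑ t ∈ Finset.Ico (S.pos u) (S.pos v),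
      gen R G (Fin.cons (S.b t) (Fin.cons (S.b (t + 1)) z : Fin (k + 1) → V) : Fin (k + 2) → V) :=
  if_pos ⟨hu, hv⟩

theorem path_of_not_mem {u v : V} (h : ¬ (u ∈ S.mem ∧ v ∈ S.mem)) {k : ℕ} (z : Fin k → V) :
    S.path R u v z = 0 :=
  if_neg h

theorem path_self (u : V) {k : ℕ} (z : Fin k → V) : S.path R u u z = 0 := by
  simp [path]

theorem path_add {u v w : V} (hu : u ∈ S.mem) (hv : v ∈ S.mem) (hw : w ∈ S.mem)
    (huv : Reachable G u v) (hvw : Reachable G v w) {k : ℕ} (z : Fin k → V) :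
    S.path R u v z + S.path R v w z = S.path R u w z := by
  rw [path_of_mem R hu hv, path_of_mem R hv hw, path_of_mem R hu hw,
    Finset.sum_Ico_consecutive _ (S.pos_le _ hu _ hv huv) (S.pos_le _ hv _ hw hvw)]

theorem reachable_b_of_lt {v : V} (hv : v ∈ S.mem) {t : ℕ} (ht : t < S.pos v) :
    Reachable G (S.b (t + 1)) v := by
  have := S.reachable_b (t + 1) (S.pos v) ht
  rwa [S.b_pos v hv] at this

/-- The faces deleting an end of an inserted edge telescope along the spine; the others only touch
`y`. -/
theorem bd_path {u v : V} (hu : u ∈ S.mem) (hv : v ∈ S.mem) (huv : Reachable G u v) {k : ℕ}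
    (y : Fin (k + 1) → V) (hvy : Reachable G v (y 0)) (hy : IsWalk G y) :
    bd R G (k + 1) (S.path R u v y) =
      gen R G (Fin.cons v y : Fin (k + 2) → V) - gen R G (Fin.cons u y : Fin (k + 2) → V) +
        ∑ i : Fin (k + 1), (-1 : R) ^ (i : ℕ) • S.path R u v (y ∘ i.succAbove) := by
  simp only [path_of_mem R hu hv, map_sum]
  rw [Finset.sum_congr rfl fun t ht => boundary_gen_cons_cons R (S.b t) (S.b (t + 1)) y
    (isWalk_cons.2 ⟨S.reachable_b t (t + 1) t.le_succ, isWalk_cons.2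
      ⟨(reachable_b_of_lt hv (Finset.mem_Ico.1 ht).2).trans hvy, hy⟩⟩),
    Finset.sum_add_distrib, Finset.sum_Ico_sub (fun t => gen R G (Fin.cons (S.b t) y))
      (S.pos_le u hu v hv huv), S.b_pos u hu, S.b_pos v hv, Finset.sum_comm]
  simp only [Finset.smul_sum]

theorem bd_path_nil {u v : V} (hu : u ∈ S.mem) (hv : v ∈ S.mem) (huv : Reachable G u v) :
    bd R G 0 (S.path R u v ![]) = gen R G ![v] - gen R G ![u] := by
  rw [path_of_mem R hu hv, map_sum]
  have : ∀ t ∈ Finset.Ico (S.pos u) (S.pos v), bd R G 0 (gen R G ![S.b t, S.b (t + 1)]) =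
      gen R G ![S.b (t + 1)] - gen R G ![S.b t] := fun t _ =>
    boundary_gen_pair R _ _ (S.reachable_b t (t + 1) t.le_succ)
  refine (Finset.sum_congr rfl this).trans ?_
  rw [Finset.sum_Ico_sub (fun t => gen R G ![S.b t]) (S.pos_le u hu v hv huv), S.b_pos u hu,
    S.b_pos v hv]

theorem path_mem_filt_nil (u v : V) : S.path R u v ![] ∈ filt R G 1 1 := by
  rw [path]
  split_ifs with h
  · refine Submodule.sum_mem _ fun t _ => gen_mem_filt R ⟨1, ?_, le_rfl⟩
    rw [length_cons]
    simpa [length] using dist_b_succ t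
  · exact Submodule.zero_mem _

theorem path_mem_filt {u v : V} {k : ℕ} {y : Fin (k + 1) → V} {p : ℤ}
    (h : ∀ t, S.pos u ≤ t → t < S.pos v →
      ∃ n : ℕ, 1 + (dist G (S.b (t + 1)) (y 0) + length G y) ≤ n ∧ (n : ℤ) ≤ p) :
    S.path R u v y ∈ filt R G p (k + 2) := by
  rw [path]
  split_ifs
  · refine Submodule.sum_mem _ fun t ht => gen_mem_filt R ?_
    obtain ⟨n, hn, hp⟩ := h t (Finset.mem_Ico.1 ht).1 (Finset.mem_Ico.1 ht).2
    refine ⟨n, le_trans ?_ hn, hp⟩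
    rw [length_cons, length_cons]
    gcongr
    exact dist_b_succ t
  · exact Submodule.zero_mem _

variable (S)

open Classical in
/-- The sum of the edges of the spine from its initial vertex to `v`, for `v` on the spine and not
terminal. -/
def base (v : V) : RC R G 1 := if v = S.top then 0 else S.path R (S.b 0) v ![]

/-- The contracting homotopy of a spine. -/
def homotopy : ∀ k, RC R G k →ₗ[R] RC R G (k + 1)
  | 0 => Finsupp.linearCombination R fun x => S.base R (x.1 0)
  -- By `bd_path` the boundary of this path contains the tuple itself with sign `-1`; the sign here
  -- makes it cancel in `1 - ∂h`.
  | (_ + 1) => Finsupp.linearCombination R fun x => -S.path R (x.1 0) (x.1 1) (Fin.tail x.1)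

variable {S}

/-! ### Values of the homotopy and of the deformation on generators -/

theorem homotopy_zero_gen (x : Fin 1 → V) : S.homotopy R 0 (gen R G x) = S.base R (x 0) := by
  have hx : IsGen G x := fun i => i.elim0
  rw [gen, dif_pos hx]
  simp [homotopy]

/-- Faces of generators can be degenerate, so the formula must vanish on them: a repetition at the
front gives an empty path, a later one persists in every term. -/
theorem homotopy_succ_gen {k : ℕ} (x : Fin (k + 2) → V) (hx : IsWalk G x) :
    S.homotopy R (k + 1) (gen R G x) = -S.path R (x 0) (x 1) (Fin.tail x) := by
  by_cases h : IsGen G x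
  · rw [gen, dif_pos h]
    simp [homotopy]
  · rw [gen, dif_neg h, map_zero]
    obtain ⟨i, hi⟩ := exists_eq_of_not_isGen hx h
    refine Eq.symm (neg_eq_zero.2 ?_)
    revert hi
    refine Fin.cases (fun hi => ?_) (fun j hi => ?_) i
    · change x 0 = x 1 at hi
      rw [hi, path_self]
    · rw [path]
      split_ifs
      · refine Finset.sum_eq_zero fun t _ => gen_eq_zero R j.succ.succ ?_
        exact hi
      · rfl

theorem base_of_not_mem {v : V} (hv : v ∉ S.mem) : S.base R v = 0 := by
  rw [base]
  split_ifs
  · rfl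
  · exact path_of_not_mem R (fun h => hv h.2) _

/-- The last edge of the spine is not collapsed, so the path up to `top` would not be killed by the
contraction; hence the value zero. -/
theorem base_top : S.base R S.top = 0 := if_pos rfl

theorem base_of_ne {v : V} (hv : v ≠ S.top) : S.base R v = S.path R (S.b 0) v ![] := if_neg hv

theorem base_b_zero : S.base R (S.b 0) = 0 := by
  rw [base_of_ne R S.b_zero_ne_top, path_self]

theorem reachable_of_mem {v : V} (hv : v ∈ S.mem) : Reachable G (S.b 0) v := by
  have := S.reachable_b 0 (S.pos v) (Nat.zero_le _)
  rwa [S.b_pos v hv] at this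

theorem deform_zero_of_mem {x : Fin 1 → V} (hx : x 0 ∈ S.mem) (ht : x 0 ≠ S.top) :
    deform (S.homotopy R) 0 (gen R G x) = gen R G ![S.b 0] := by
  have e : x = ![x 0] := by funext i; rw [Subsingleton.elim i 0]; rfl
  rw [deform_zero_apply, homotopy_zero_gen, base_of_ne R ht,
    bd_path_nil R S.b_zero_mem hx (reachable_of_mem hx), ← e]
  abel

theorem deform_zero_of_base {x : Fin 1 → V} (hx : S.base R (x 0) = 0) :
    deform (S.homotopy R) 0 (gen R G x) = gen R G x := by
  rw [deform_zero_apply, homotopy_zero_gen, hx, map_zero, sub_zero]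

theorem deform_one_of_mem {u v : V} (hu : u ∈ S.mem) (hv : v ∈ S.mem) (huv : Reachable G u v) :
    deform (S.homotopy R) 1 (gen R G ![u, v]) = S.path R u v ![] - S.base R v + S.base R u := by
  have hw : IsWalk G ![u, v] := isWalk_cons.2 ⟨huv, fun i => i.elim0⟩
  rw [deform_succ_apply, boundary_gen_pair R u v huv, homotopy_succ_gen R _ hw, map_sub,
    homotopy_zero_gen, homotopy_zero_gen, map_neg]
  change _ - -(bd R G 1 (S.path R u v ![v])) - (S.base R v - S.base R u) = _
  rw [bd_path R hu hv huv ![v] ⟨0, .nil _⟩ (fun i => i.elim0), Fin.sum_univ_one]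
  have e1 : gen R G (Fin.cons v ![v] : Fin 2 → V) = 0 := gen_cons_self R ![v]
  have e2 : (![v] ∘ (0 : Fin 1).succAbove : Fin 0 → V) = ![] := Subsingleton.elim _ _
  have e3 : (Fin.cons u ![v] : Fin 2 → V) = ![u, v] := rfl
  rw [e1, e2, e3, Fin.val_zero, pow_zero, one_smul]
  abel

theorem deform_one_of_not_mem {u v : V} (h : ¬ (u ∈ S.mem ∧ v ∈ S.mem)) (huv : Reachable G u v) :
    deform (S.homotopy R) 1 (gen R G ![u, v]) = gen R G ![u, v] := by
  have hw : IsWalk G ![u, v] := isWalk_cons.2 ⟨huv, fun i => i.elim0⟩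
  have hv : S.base R v = 0 := by
    by_cases hv : v ∈ S.mem
    · by_cases ht : v = S.top
      · rw [ht, base_top]
      · exact absurd ⟨S.mem_of_reachable u v hv ht huv, hv⟩ h
    · exact base_of_not_mem R hv
  have hu : S.base R u = 0 := by
    by_cases hu : u ∈ S.mem
    · rw [S.eq_of_reachable u hu v (fun hv => h ⟨hu, hv⟩) huv, base_b_zero]
    · exact base_of_not_mem R hu
  rw [deform_succ_apply, boundary_gen_pair R u v huv, homotopy_succ_gen R _ hw, map_sub,
    homotopy_zero_gen, homotopy_zero_gen, map_neg]
  change _ - -(bd R G 1 (S.path R u v ![v])) - (S.base R v - S.base R u) = _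
  rw [path_of_not_mem R h, hu, hv]
  simp

theorem homotopy_bd_gen {k : ℕ} (u v : V) (w : Fin (k + 1) → V)
    (h : IsWalk G (Fin.cons u (Fin.cons v w : Fin (k + 2) → V) : Fin (k + 3) → V)) :
    S.homotopy R (k + 1) (bd R G (k + 1)
      (gen R G (Fin.cons u (Fin.cons v w : Fin (k + 2) → V) : Fin (k + 3) → V))) =
      S.path R u (w 0) w - S.path R v (w 0) w - ∑ i : Fin (k + 1), (-1 : R) ^ (i : ℕ) •
        S.path R u v (Fin.cons v (w ∘ i.succAbove) : Fin (k + 1) → V) := by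
  obtain ⟨h0, h1⟩ := isWalk_cons.1 h
  obtain ⟨h2, h3⟩ := isWalk_cons.1 h1
  have hf : ∀ i : Fin (k + 1), IsWalk G
      (Fin.cons u (Fin.cons v (w ∘ i.succAbove) : Fin (k + 1) → V) : Fin (k + 2) → V) := by
    intro i
    rw [← cons_comp_succAbove_succ, ← cons_comp_succAbove_succ]
    exact reachable_face h _
  rw [boundary_gen_cons_cons R u v w h, map_add, map_sub, map_sum, homotopy_succ_gen R _ h1,
    homotopy_succ_gen R _ (isWalk_cons.2 ⟨h0.trans h2, h3⟩)]
  simp only [map_smul]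
  rw [Finset.sum_congr rfl fun i _ => by rw [homotopy_succ_gen R _ (hf i)]]
  simp only [smul_neg, Finset.sum_neg_distrib]
  change -S.path R v (w 0) w - -S.path R u (w 0) w + -∑ i : Fin (k + 1), (-1 : R) ^ (i : ℕ) •
        S.path R u v (Fin.cons v (w ∘ i.succAbove) : Fin (k + 1) → V) = _
  abel

/-- Faces that delete an entry of `w` cancel between `∂h` and `h∂`. What remains is a triangle of
paths, which vanishes by `path_add` once `w 0` is on the spine. -/
theorem deform_of_mem {k : ℕ} {u v : V} {w : Fin (k + 1) → V}
    (h : IsWalk G (Fin.cons u (Fin.cons v w : Fin (k + 2) → V) : Fin (k + 3) → V))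
    (hu : u ∈ S.mem) (hv : v ∈ S.mem) :
    deform (S.homotopy R) (k + 2)
      (gen R G (Fin.cons u (Fin.cons v w : Fin (k + 2) → V) : Fin (k + 3) → V)) =
      S.path R u v w + S.path R v (w 0) w - S.path R u (w 0) w := by
  obtain ⟨h0, h1⟩ := isWalk_cons.1 h
  rw [deform_succ_apply, homotopy_bd_gen R u v w h, homotopy_succ_gen R _ h, map_neg]
  change _ - -(bd R G (k + 2) (S.path R u v (Fin.cons v w : Fin (k + 2) → V))) - _ = _
  rw [bd_path R hu hv h0 _ ⟨0, .nil _⟩ h1, Fin.sum_univ_succ, cons_comp_succAbove_zero,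
    gen_cons_cons_self]
  simp only [cons_comp_succAbove_succ, Fin.val_zero, pow_zero, one_smul, Fin.val_succ, pow_succ,
    mul_neg, mul_one, neg_smul, Finset.sum_neg_distrib]
  abel

theorem deform_of_not_mem {k : ℕ} {u v : V} {w : Fin (k + 1) → V}
    (h : IsWalk G (Fin.cons u (Fin.cons v w : Fin (k + 2) → V) : Fin (k + 3) → V))
    (huv : ¬ (u ∈ S.mem ∧ v ∈ S.mem)) :
    deform (S.homotopy R) (k + 2)
      (gen R G (Fin.cons u (Fin.cons v w : Fin (k + 2) → V) : Fin (k + 3) → V)) =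
      gen R G (Fin.cons u (Fin.cons v w : Fin (k + 2) → V) : Fin (k + 3) → V) +
        S.path R v (w 0) w - S.path R u (w 0) w := by
  rw [deform_succ_apply, homotopy_bd_gen R u v w h, homotopy_succ_gen R _ h, map_neg]
  change _ - -(bd R G (k + 2) (S.path R u v (Fin.cons v w : Fin (k + 2) → V))) - _ = _
  simp only [path_of_not_mem R huv, map_zero, smul_zero, Finset.sum_const_zero]
  abel

end Spine

/-! ### Checking linear maps on generators -/

theorem exists_cons_cons {k : ℕ} (x : Fin (k + 3) → V) :
    ∃ (u v : V) (w : Fin (k + 1) → V),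
      x = (Fin.cons u (Fin.cons v w : Fin (k + 2) → V) : Fin (k + 3) → V) :=
  ⟨x 0, Fin.tail x 0, Fin.tail (Fin.tail x), by rw [Fin.cons_self_tail, Fin.cons_self_tail]⟩

theorem eq_pair (x : Fin 2 → V) : x = ![x 0, x 1] := by
  funext i
  fin_cases i <;> rfl

theorem map_mem_filt_of_gen {k j : ℕ} (L : RC R H k →ₗ[R] RC R G j) {p q : ℤ}
    (hL : ∀ y : Fin (k + 1) → W, IsGen H y → ∀ n : ℕ, length H y ≤ n → (n : ℤ) ≤ p →
      L (gen R H y) ∈ filt R G q j) {c : RC R H k} (hc : c ∈ filt R H p k) :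
    L c ∈ filt R G q j := by
  rw [← Finsupp.sum_single c, Finsupp.sum, map_sum]
  refine Submodule.sum_mem _ fun y hy => ?_
  obtain ⟨n, hn, hp⟩ := (Finsupp.mem_supported R c).1 hc hy
  have e : Finsupp.single y (c y) = c y • gen R H y.1 := by
    rw [gen, dif_pos y.2]
    simp
  rw [e, map_smul]
  exact Submodule.smul_mem _ _ (hL y.1 y.2 n hn hp)

theorem linearMap_ext_gen {M : Type*} [AddCommGroup M] [Module R M] {k : ℕ}
    {L L' : RC R G k →ₗ[R] M} (h : ∀ x, IsGen G x → L (gen R G x) = L' (gen R G x)) : L = L' := by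
  refine Finsupp.lhom_ext fun x a => ?_
  have e : Finsupp.single x a = a • gen R G x.1 := by
    rw [gen, dif_pos x.2]
    simp
  rw [e, map_smul, map_smul, h x.1 x.2]

theorem one_le_dist {u v : V} (h : u ≠ v) : 1 ≤ dist G u v := by
  refine le_iInf₂ fun j p => ?_
  cases p with
  | nil => exact absurd rfl h
  | cons => exact_mod_cast Nat.le_add_left _ _

/-! ### The homotopy against the filtration and against a contraction -/

namespace Spine

variable {S : Spine G}

/-- The inserted edge costs at most one, and what is left of the spine up to `x 1` is no longer than
the distance from `x 0` to `x 1`. In degree `0` a vertex of length `0` becomes a sum of edges of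
length at most `1`. -/
theorem homotopy_mem_filt (k : ℕ) (p : ℤ) (c : RC R G k) (hc : c ∈ filt R G p k) :
    S.homotopy R k c ∈ filt R G (p + 1) (k + 1) := by
  refine map_mem_filt_of_gen R _ (fun x hx n hn hp => ?_) hc
  cases k with
  | zero =>
    rw [homotopy_zero_gen, base]
    split_ifs
    · exact Submodule.zero_mem _
    · exact filt_mono R (by omega) _ (path_mem_filt_nil R _ _)
  | succ k =>
    rw [homotopy_succ_gen R x hx.isWalk]
    by_cases h : x 0 ∈ S.mem ∧ x 1 ∈ S.mem
    · refine Submodule.neg_mem _ (path_mem_filt R fun t h1 h2 => ⟨n + 1, ?_, by push_cast; omega⟩)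
      have e : length G x = dist G (x 0) (x 1) + length G (Fin.tail x) := by
        conv_lhs => rw [← Fin.cons_self_tail x]
        rw [length_cons]
        rfl
      have d1 : dist G (S.b (t + 1)) (x 1) ≤ dist G (x 0) (x 1) := by
        have := S.dist_b_le (t + 1) (S.pos (x 1)) h2
        rw [S.b_pos _ h.2] at this
        refine this.trans (le_trans ?_ (S.le_dist _ h.1 _ h.2))
        exact_mod_cast (by omega)
      rw [Nat.cast_add, Nat.cast_one, add_comm]
      gcongr
      refine le_trans ?_ hn
      rw [e]
      gcongr
      exact d1
    · rw [path_of_not_mem R h, neg_zero]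
      exact Submodule.zero_mem _

/-- All edges but the last one are collapsed by `f`. The last one occurs only when `v` is terminal,
and then its end is repeated at the start of `y`. -/
theorem RCmap_path_eq_zero (f : GraphMap G H)
    (hf : ∀ t < S.pos S.top, f.toFun (S.b t) = f.toFun (S.b 0))
    {u v : V} {k : ℕ} (y : Fin k → V)
    (hv : v = S.top → ∃ hk : 0 < k, y ⟨0, hk⟩ = v)
    (hw : v ∈ S.mem → IsWalk G (Fin.cons v y : Fin (k + 1) → V)) :
    RCmap R f (k + 1) (S.path R u v y) = 0 := by
  rw [path]
  split_ifs with h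
  · rw [map_sum]
    refine Finset.sum_eq_zero fun t ht => ?_
    have ht' := (Finset.mem_Ico.1 ht).2
    have hwalk : IsWalk G (Fin.cons (S.b t) (Fin.cons (S.b (t + 1)) y : Fin (k + 1) → V) :
        Fin (k + 2) → V) := by
      refine isWalk_cons.2 ⟨S.reachable_b t (t + 1) t.le_succ, ?_⟩
      cases k with
      | zero => exact fun i => i.elim0
      | succ k =>
        obtain ⟨h1, h2⟩ := isWalk_cons.1 (hw h.2)
        exact isWalk_cons.2 ⟨(reachable_b_of_lt h.2 ht').trans h1, h2⟩
    by_cases hlt : t + 1 < S.pos S.top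
    · rw [RCmap_gen R f _ hwalk]
      refine gen_eq_zero R 0 ?_
      change f.toFun (S.b t) = f.toFun (S.b (t + 1))
      rw [hf t (by omega), hf (t + 1) hlt]
    · have hvt : v = S.top := by
        by_contra hne
        have := S.pos_lt_pos_top v h.2 hne
        omega
      obtain ⟨hk, hy⟩ := hv hvt
      obtain ⟨k, rfl⟩ : ∃ j, k = j + 1 := ⟨k - 1, by omega⟩
      rw [gen_eq_zero R 1, map_zero]
      change S.b (t + 1) = y 0
      have : t + 1 = S.pos v := by rw [hvt] at ht' ⊢; omega
      rw [this, S.b_pos v h.2]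
      exact hy.symm
  · exact map_zero _

theorem RCmap_homotopy (f : GraphMap G H)
    (hf : ∀ t < S.pos S.top, f.toFun (S.b t) = f.toFun (S.b 0)) (k : ℕ) (c : RC R G k) :
    RCmap R f (k + 1) (S.homotopy R k c) = 0 := by
  have : RCmap R f (k + 1) ∘ₗ S.homotopy R k = 0 := by
    refine linearMap_ext_gen R fun x hx => ?_
    rw [LinearMap.comp_apply, LinearMap.zero_apply]
    cases k with
    | zero =>
      rw [homotopy_zero_gen, base]
      split_ifs with h
      · exact map_zero _
      · exact RCmap_path_eq_zero R f hf _ (fun e => absurd e h) fun _ i => i.elim0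
    | succ k =>
      rw [homotopy_succ_gen R x hx.isWalk, map_neg, neg_eq_zero]
      refine RCmap_path_eq_zero R f hf _ (fun _ => ⟨k.succ_pos, rfl⟩) fun _ => ?_
      exact isWalk_cons.2 ⟨⟨0, .nil _⟩, fun i => hx.isWalk i.succ⟩
  exact LinearMap.congr_fun this c

/-! ### The deformation factors through the retraction of the spine -/

variable (S)

open Classical in
/-- The map of vertices contracting all of the spine except its terminal vertex. -/
def retract (v : V) : V := if v ∈ S.mem ∧ v ≠ S.top then S.b 0 else v

variable {S}

theorem retract_of_mem {v : V} (hv : v ∈ S.mem) (ht : v ≠ S.top) : S.retract v = S.b 0 :=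
  if_pos ⟨hv, ht⟩

theorem retract_top : S.retract S.top = S.top := if_neg fun h => h.2 rfl

theorem retract_of_not_mem {v : V} (hv : v ∉ S.mem) : S.retract v = v := if_neg fun h => hv h.1

theorem retract_b_zero : S.retract (S.b 0) = S.b 0 := retract_of_mem S.b_zero_mem S.b_zero_ne_top

/-- A nonterminal spine vertex after the first entry would force all entries before it onto the
spine, in particular `u` and `v`. A first entry on the spine from which the tuple leaves is `b 0`.
-/
theorem retract_eq_self_of_not_mem {k : ℕ} {u v : V} {w : Fin (k + 1) → V}
    (h : IsGen G (Fin.cons u (Fin.cons v w : Fin (k + 2) → V) : Fin (k + 3) → V))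
    (huv : ¬ (u ∈ S.mem ∧ v ∈ S.mem)) :
    S.retract ∘ (Fin.cons u (Fin.cons v w : Fin (k + 2) → V) : Fin (k + 3) → V) =
      (Fin.cons u (Fin.cons v w : Fin (k + 2) → V) : Fin (k + 3) → V) := by
  obtain ⟨h0, h1⟩ := isWalk_cons.1 h.isWalk
  change Reachable G u v at h0
  funext i
  refine Fin.cases ?_ (fun i => ?_) i
  · change S.retract u = u
    by_cases hu : u ∈ S.mem
    · rw [S.eq_of_reachable u hu v (fun hv => huv ⟨hu, hv⟩) h0, retract_b_zero]
    · exact retract_of_not_mem hu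
  · simp only [Function.comp, Fin.cons_succ]
    set a := (Fin.cons v w : Fin (k + 2) → V) i with ha
    by_cases hm : a ∈ S.mem
    · by_cases ht : a = S.top
      · rw [ht, retract_top]
      · have hv : v ∈ S.mem := S.mem_of_reachable v a hm ht (h1.reachable_zero i)
        have hvt : v ≠ S.top := by
          intro e
          have := S.top_reachable a (e ▸ h1.reachable_zero i)
          exact ht this
        exact absurd ⟨S.mem_of_reachable u v hv hvt h0, hv⟩ huv
    · exact retract_of_not_mem hm

/-- The spine can be left only from `b 0`, and `v` is already past it; so `w 0` lies on the spine
too and the triangle of paths closes. -/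
theorem deform_gen_of_mem {k : ℕ} {u v : V} {w : Fin (k + 1) → V}
    (h : IsGen G (Fin.cons u (Fin.cons v w : Fin (k + 2) → V) : Fin (k + 3) → V))
    (hu : u ∈ S.mem) (hv : v ∈ S.mem) :
    deform (S.homotopy R) (k + 2)
      (gen R G (Fin.cons u (Fin.cons v w : Fin (k + 2) → V) : Fin (k + 3) → V)) = 0 := by
  have h0 : u ≠ v ∧ Reachable G u v := h 0
  have h1 : v ≠ w 0 ∧ Reachable G v (w 0) := h 1
  have hw : w 0 ∈ S.mem := by
    by_contra hw
    have e := S.eq_of_reachable v hv _ hw h1.2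
    have := S.pos_le u hu v hv h0.2
    rw [e, S.pos_b_zero, Nat.le_zero] at this
    exact h0.1 (by rw [e, ← this, S.b_pos u hu])
  rw [deform_of_mem R h.isWalk hu hv, path_add R hu hv hw h0.2 h1.2, sub_self]

theorem ne_top_of_reachable {u v : V} (h : Reachable G u v) (hne : u ≠ v) : u ≠ S.top := by
  rintro rfl
  exact hne (S.top_reachable v h).symm

theorem deform_one_of_ne_top {u v : V} (hu : u ∈ S.mem) (hv : v ∈ S.mem) (huv : Reachable G u v)
    (hne : u ≠ v) (ht : v ≠ S.top) : deform (S.homotopy R) 1 (gen R G ![u, v]) = 0 := by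
  rw [deform_one_of_mem R hu hv huv, base_of_ne R ht, base_of_ne R (ne_top_of_reachable huv hne),
    ← path_add R S.b_zero_mem hu hv (reachable_of_mem hu) huv]
  abel

theorem deform_one_top {u : V} (hu : u ∈ S.mem) (hne : u ≠ S.top) (h : Reachable G u S.top) :
    deform (S.homotopy R) 1 (gen R G ![u, S.top]) = S.path R (S.b 0) S.top ![] := by
  rw [deform_one_of_mem R hu S.top_mem h, base_top, base_of_ne R hne,
    ← path_add R S.b_zero_mem hu S.top_mem (reachable_of_mem hu) h]
  abel

/-- This is what lets the deformation factor through the contraction, which identifies a tuple with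
its retraction. -/
theorem deform_gen_retract {k : ℕ} {x : Fin (k + 1) → V} (hx : IsGen G x) :
    deform (S.homotopy R) k (gen R G (S.retract ∘ x)) = deform (S.homotopy R) k (gen R G x) := by
  match k with
  | 0 =>
    by_cases h : x 0 ∈ S.mem ∧ x 0 ≠ S.top
    · have e : S.retract ∘ x = ![S.b 0] := by
        funext i
        rw [Subsingleton.elim (α := Fin 1) i 0]
        exact retract_of_mem h.1 h.2
      rw [deform_zero_of_mem R h.1 h.2, e, deform_zero_of_mem R]
      · exact S.b_zero_mem
      · exact S.b_zero_ne_top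
    · have e : S.retract ∘ x = x := by
        funext i
        rw [Subsingleton.elim (α := Fin 1) i 0]
        exact if_neg h
      rw [e]
  | 1 =>
    rw [eq_pair x]
    have h := hx 0
    change x 0 ≠ x 1 ∧ Reachable G (x 0) (x 1) at h
    have e : S.retract ∘ ![x 0, x 1] = ![S.retract (x 0), S.retract (x 1)] := by
      funext i
      fin_cases i <;> rfl
    rw [e]
    by_cases hm : x 0 ∈ S.mem ∧ x 1 ∈ S.mem
    · have h0 := ne_top_of_reachable (S := S) h.2 h.1
      by_cases ht : x 1 = S.top
      · rw [ht] at h ⊢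
        rw [retract_of_mem hm.1 h0, retract_top, deform_one_top R hm.1 h0 h.2,
          deform_one_top R S.b_zero_mem S.b_zero_ne_top (reachable_of_mem S.top_mem)]
      · rw [retract_of_mem hm.1 h0, retract_of_mem hm.2 ht,
          deform_one_of_ne_top R hm.1 hm.2 h.2 h.1 ht, gen_eq_zero R 0 rfl, map_zero]
    · have e0 : S.retract (x 0) = x 0 := by
        by_cases hu : x 0 ∈ S.mem
        · rw [S.eq_of_reachable _ hu _ (fun hv => hm ⟨hu, hv⟩) h.2, retract_b_zero]
        · exact retract_of_not_mem hu
      have e1 : S.retract (x 1) = x 1 := by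
        by_cases hv : x 1 ∈ S.mem
        · by_cases ht : x 1 = S.top
          · rw [ht, retract_top]
          · exact absurd ⟨S.mem_of_reachable _ _ hv ht h.2, hv⟩ hm
        · exact retract_of_not_mem hv
      rw [e0, e1]
  | k + 2 =>
    obtain ⟨u, v, w, rfl⟩ := exists_cons_cons x
    by_cases hm : u ∈ S.mem ∧ v ∈ S.mem
    · have h0 : u ≠ v ∧ Reachable G u v := hx 0
      have h1 : v ≠ w 0 ∧ Reachable G v (w 0) := hx 1
      rw [deform_gen_of_mem R hx hm.1 hm.2, gen_eq_zero R 0, map_zero]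
      change S.retract u = S.retract v
      rw [retract_of_mem hm.1 (ne_top_of_reachable h0.2 h0.1),
        retract_of_mem hm.2 (ne_top_of_reachable h1.2 h1.1)]
    · rw [retract_eq_self_of_not_mem hx hm]

/-- A map of directed graphs that collapses a spine, except for its terminal vertex, to a point,
and such that the distances in the target are not too small. -/
structure Collapse (S : Spine G) (f : GraphMap G H) where
  sec : W → V
  map_sec : ∀ y, f.toFun (sec y) = y
  sec_map : ∀ x, sec (f.toFun x) = S.retract x
  reachable_sec : ∀ u v, Reachable H u v → Reachable G (sec u) (sec v)
  -- Pairs on the spine are excepted because the collapse may shorten their distance.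
  dist_sec_le : ∀ u v, Reachable H u v → ¬ (sec u ∈ S.mem ∧ sec v ∈ S.mem) →
    dist G (sec u) (sec v) ≤ dist H u v
  -- A detour off the spine is at least as long as the spine; this bounds the correction term of the
  -- deformation.
  le_dist_add_dist : ∀ u v w, Reachable H u v → Reachable H v w → sec u = S.b 0 → sec v ∉ S.mem →
    sec w = S.top → (S.pos S.top : ℕ∞) ≤ dist H u v + dist H v w

namespace Collapse

variable {f : GraphMap G H} (K : S.Collapse f)

include K

theorem map_b {t : ℕ} (ht : t < S.pos S.top) : f.toFun (S.b t) = f.toFun (S.b 0) := by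
  have hp := S.pos_b t ht.le
  have hne : S.b t ≠ S.top := by
    intro e
    rw [e] at hp
    omega
  rw [← K.map_sec (f.toFun (S.b t)), ← K.map_sec (f.toFun (S.b 0)), K.sec_map, K.sec_map,
    retract_of_mem (S.b_mem t ht.le) hne, retract_b_zero]

theorem isWalk_sec {k : ℕ} {y : Fin (k + 1) → W} (hy : IsWalk H y) : IsWalk G (K.sec ∘ y) :=
  fun i => K.reachable_sec _ _ (hy i)

theorem isGen_sec {k : ℕ} {y : Fin (k + 1) → W} (hy : IsGen H y) : IsGen G (K.sec ∘ y) :=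
  fun i => ⟨fun h => (hy i).1 (by
    rw [← K.map_sec (y i.castSucc), ← K.map_sec (y i.succ)]
    exact congrArg f.toFun h), K.reachable_sec _ _ (hy i).2⟩

theorem retract_sec (y : W) : S.retract (K.sec y) = K.sec y := by
  rw [← K.sec_map, K.map_sec]

theorem sec_eq {y : W} (hy : K.sec y ∈ S.mem) : K.sec y = S.b 0 ∨ K.sec y = S.top := by
  by_cases h : K.sec y = S.top
  · exact Or.inr h
  · left
    rw [← K.retract_sec, retract_of_mem hy h]

theorem surjective (k : ℕ) : Function.Surjective (RCmap R f k) := by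
  rw [← LinearMap.range_eq_top, eq_top_iff]
  rintro c -
  rw [← Finsupp.sum_single c, Finsupp.sum]
  refine Submodule.sum_mem _ fun y _ => ⟨c y • gen R G (K.sec ∘ y.1), ?_⟩
  have e : f.toFun ∘ K.sec ∘ y.1 = y.1 := funext fun i => K.map_sec _
  rw [map_smul, RCmap_gen R f _ (K.isWalk_sec y.2.isWalk), e, gen, dif_pos y.2]
  simp

theorem length_sec_le {k : ℕ} {y : Fin (k + 1) → W} (hy : IsWalk H y)
    (h : ∀ i : Fin k, ¬ (K.sec (y i.castSucc) ∈ S.mem ∧ K.sec (y i.succ) ∈ S.mem)) :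
    length G (K.sec ∘ y) ≤ length H y :=
  Finset.sum_le_sum fun i _ => K.dist_sec_le _ _ (hy i) (h i)

/-- Lifts meet the spine only in `b 0` and `top`. If `v` lifts to the spine, having a successor
makes its lift `b 0`, and then its predecessor lifts to `b 0` as well. -/
theorem not_mem_of_pred {u v w : W} (huv : Reachable H u v) (hne : u ≠ v) (hvw : Reachable H v w)
    (hne' : v ≠ w) : ¬ (K.sec v ∈ S.mem ∧ K.sec w ∈ S.mem) := by
  rintro ⟨hv, -⟩
  have inj : ∀ {a b : W}, a ≠ b → K.sec a ≠ K.sec b := fun {a b} h e => h (by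
    rw [← K.map_sec a, e, K.map_sec])
  have hvt := ne_top_of_reachable (S := S) (K.reachable_sec _ _ hvw) (inj hne')
  have hut := ne_top_of_reachable (S := S) (K.reachable_sec _ _ huv) (inj hne)
  have hu := S.mem_of_reachable _ _ hv hvt (K.reachable_sec _ _ huv)
  exact inj hne (((K.sec_eq hu).resolve_right hut).trans ((K.sec_eq hv).resolve_right hvt).symm)

/-- Only a pair on the spine makes the lift too long, and it can occur only at the front. In degree
`1` the deformation turns it into edges, in higher degrees into `0`. Otherwise the lift survives, up
to a correction term in degree at least `2`. -/
theorem deform_sec_mem_filt {k : ℕ} {y : Fin (k + 1) → W} (hy : IsGen H y) {n : ℕ}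
    (hn : length H y ≤ n) :
    deform (S.homotopy R) k (gen R G (K.sec ∘ y)) ∈ filt R G n k := by
  match k with
  | 0 =>
    have h0 : ∀ z : Fin 1 → V, gen R G z ∈ filt R G n 0 := fun z =>
      gen_mem_filt R ⟨n, by simp [length], le_rfl⟩
    by_cases h : (K.sec ∘ y) 0 ∈ S.mem ∧ (K.sec ∘ y) 0 ≠ S.top
    · rw [deform_zero_of_mem R h.1 h.2]
      exact h0 _
    · rw [deform_zero_of_base R]
      · exact h0 _
      · by_cases hm : (K.sec ∘ y) 0 ∈ S.mem
        · rw [not_not.1 fun ht => h ⟨hm, ht⟩, base_top]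
        · exact base_of_not_mem R hm
  | 1 =>
    have h := K.isGen_sec hy 0
    change K.sec (y 0) ≠ K.sec (y 1) ∧ Reachable G (K.sec (y 0)) (K.sec (y 1)) at h
    have e : K.sec ∘ y = ![K.sec (y 0), K.sec (y 1)] := eq_pair _
    by_cases hm : K.sec (y 0) ∈ S.mem ∧ K.sec (y 1) ∈ S.mem
    · have h0 := ne_top_of_reachable (S := S) h.2 h.1
      have hn1 : 1 ≤ n := by
        have h1 : (1 : ℕ∞) ≤ dist H (y 0) (y 1) := one_le_dist (hy 0).1
        have h2 : length H y = dist H (y 0) (y 1) := by simp [length]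
        rw [h2] at hn
        exact_mod_cast h1.trans hn
      rw [e]
      by_cases ht : K.sec (y 1) = S.top
      · rw [ht] at h ⊢
        rw [deform_one_top R hm.1 h0 h.2]
        exact filt_mono R (by exact_mod_cast hn1) _ (path_mem_filt_nil R _ _)
      · rw [deform_one_of_ne_top R hm.1 hm.2 h.2 h.1 ht]
        exact Submodule.zero_mem _
    · rw [e, deform_one_of_not_mem R hm h.2, ← e]
      refine gen_mem_filt R ⟨n, (K.length_sec_le hy.isWalk fun i => ?_).trans hn, le_rfl⟩
      rw [Subsingleton.elim i 0]
      exact hm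
  | k + 2 =>
    obtain ⟨u, v, w, rfl⟩ := exists_cons_cons y
    have hx := K.isGen_sec hy
    have e : K.sec ∘ (Fin.cons u (Fin.cons v w : Fin (k + 2) → W) : Fin (k + 3) → W) =
        (Fin.cons (K.sec u) (Fin.cons (K.sec v) (K.sec ∘ w) : Fin (k + 2) → V) :
          Fin (k + 3) → V) := by
      funext i
      refine Fin.cases rfl (fun i => Fin.cases rfl (fun i => rfl) i) i
    have huv : u ≠ v ∧ Reachable H u v := hy 0
    have hvw : v ≠ w 0 ∧ Reachable H v (w 0) := hy 1
    have hstep : ∀ i : Fin (k + 1),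
        ¬ (K.sec ((Fin.cons v w : Fin (k + 2) → W) i.castSucc) ∈ S.mem ∧ K.sec (w i) ∈ S.mem) :=
      fun i => K.not_mem_of_pred (hy i.castSucc).2 (hy i.castSucc).1 (hy i.succ).2 (hy i.succ).1
    rw [e] at hx ⊢
    by_cases hm : K.sec u ∈ S.mem ∧ K.sec v ∈ S.mem
    · rw [deform_gen_of_mem R hx hm.1 hm.2]
      exact Submodule.zero_mem _
    · have h0 : ¬ (K.sec v ∈ S.mem ∧ (K.sec ∘ w) 0 ∈ S.mem) := hstep 0
      rw [deform_of_not_mem R hx.isWalk hm, path_of_not_mem R h0, add_zero]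
      refine Submodule.sub_mem _ ?_ ?_
      · rw [← e]
        refine gen_mem_filt R ⟨n, (K.length_sec_le hy.isWalk fun i => ?_).trans hn, le_rfl⟩
        refine Fin.cases hm (fun i => hstep i) i
      · by_cases hm' : K.sec u ∈ S.mem ∧ K.sec (w 0) ∈ S.mem
        · have hut := ne_top_of_reachable (S := S) (hx 0).2 (hx 0).1
          have hv : K.sec v ∉ S.mem := fun hv => hm ⟨hm'.1, hv⟩
          have hwt : K.sec (w 0) = S.top := by
            by_contra hwt
            exact hv (S.mem_of_reachable _ _ hm'.2 hwt (K.reachable_sec _ _ hvw.2))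
          -- The correction is nonzero only for tuples starting with `b 0`, a vertex off the spine,
          -- and `top`; it replaces this detour by the spine.
          have hd := K.le_dist_add_dist u v (w 0) huv.2 hvw.2
            ((K.sec_eq hm'.1).resolve_right hut) hv hwt
          have hl : length G (K.sec ∘ w) ≤ length H w :=
            K.length_sec_le (fun i => (hy i.succ.succ).2) fun i => hstep i.succ
          refine path_mem_filt R fun t h1 h2 => ⟨n, le_trans ?_ hn, le_rfl⟩
          rw [length_cons, length_cons, ← add_assoc, ← add_assoc]
          refine add_le_add (le_trans ?_ hd) hl
          have hwt' : (K.sec ∘ w) 0 = S.top := hwt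
          rw [hwt'] at h2 ⊢
          have := S.dist_b_le (t + 1) _ h2
          rw [S.b_pos _ S.top_mem] at this
          refine (add_le_add_right this 1).trans ?_
          exact_mod_cast (by omega)
        · change S.path R (K.sec u) (K.sec (w 0)) (K.sec ∘ w) ∈ _
          rw [path_of_not_mem R hm']
          exact Submodule.zero_mem _

/-- The map `L` is the filtered section, and the deformation is `L` after the map induced by `f`. -/
theorem deform_mem_filt (k : ℕ) (p : ℤ) (c : RC R G k) (hc : RCmap R f k c ∈ filt R H p k) :
    deform (S.homotopy R) k c ∈ filt R G p k := by
  let L : RC R H k →ₗ[R] RC R G k := Finsupp.linearCombination R fun y =>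
    deform (S.homotopy R) k (gen R G (K.sec ∘ y.1))
  have hL : ∀ y, IsGen H y → L (gen R H y) = deform (S.homotopy R) k (gen R G (K.sec ∘ y)) := by
    intro y hy
    rw [gen, dif_pos hy]
    simp [L]
  have e : deform (S.homotopy R) k = L ∘ₗ RCmap R f k := by
    refine linearMap_ext_gen R fun x hx => ?_
    have hs : K.sec ∘ f.toFun ∘ x = S.retract ∘ x := funext fun i => K.sec_map _
    rw [LinearMap.comp_apply, RCmap_gen R f _ hx.isWalk, ← deform_gen_retract R hx, ← hs]
    by_cases hg : IsGen H (f.toFun ∘ x)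
    · rw [hL _ hg]
    · obtain ⟨i, hi⟩ := exists_eq_of_not_isGen (fun i => f.reachable (hx i).2) hg
      rw [gen_eq_zero R i hi, gen_eq_zero R i (congrArg K.sec hi), map_zero, map_zero]
  rw [e]
  refine map_mem_filt_of_gen R L (fun y hy n hn hp => ?_) hc
  rw [hL y hy]
  exact filt_mono R hp _ (K.deform_sec_mem_filt R hy hn)

theorem PHmap_bijective (k : ℕ) (l : ℤ) : Function.Bijective (PHmap R f k l) :=
  PHmap_bijective_of_homotopy f (S.homotopy R) (homotopy_mem_filt R)
    (RCmap_homotopy R f fun _ ht => K.map_b ht) (K.surjective R) (K.deform_mem_filt R) k l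

end Collapse

end Spine

/-! ### Bounds for path lengths -/

theorem HasPath.le_add {q : V → ℕ} (hq : ∀ x y, G.Adj x y → q y ≤ q x + 1) {k : ℕ} {x y : V}
    (p : HasPath G k x y) : q y ≤ q x + k := by
  induction p with
  | nil => simp
  | cons h _ ih => have := hq _ _ h; omega

theorem HasPath.dist_le {k : ℕ} {x y : V} (p : HasPath G k x y) : dist G x y ≤ k := iInf₂_le k p

/-! ### Bi-directed cycles -/

section Cycle

variable {m n : ℕ}

/-- The `t`-th vertex of the interval of length `n` in `C m n`, constant from `t = n` on. -/
def lowerVertex (m n t : ℕ) : CycleVertex m n :=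
  if h0 : t = 0 then Sum.inl 0
  else if h : t < n then Sum.inr ⟨t - 1, by omega⟩
  else Sum.inl (Fin.last m)

theorem botVertex_eq (j : Fin (n + 1)) : botVertex m n j = lowerVertex m n j := by
  have := j.2
  by_cases h0 : (j : ℕ) = 0
  · rw [botVertex, dif_pos h0, lowerVertex, dif_pos h0]
  · by_cases hn : (j : ℕ) = n
    · rw [botVertex, dif_neg h0, dif_pos hn, lowerVertex, dif_neg h0, dif_neg (by omega)]
    · rw [botVertex, dif_neg h0, dif_neg hn, lowerVertex, dif_neg h0, dif_pos (by omega)]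

theorem adj_iff {x y : CycleVertex m n} : (C m n).Adj x y ↔
    (∃ i : Fin m, x = Sum.inl i.castSucc ∧ y = Sum.inl i.succ) ∨
    (∃ t < n, x = lowerVertex m n t ∧ y = lowerVertex m n (t + 1)) := by
  refine or_congr Iff.rfl ⟨?_, ?_⟩
  · rintro ⟨j, rfl, rfl⟩
    exact ⟨j, j.2, botVertex_eq _, botVertex_eq _⟩
  · rintro ⟨t, ht, rfl, rfl⟩
    exact ⟨⟨t, ht⟩, (botVertex_eq (Fin.castSucc ⟨t, ht⟩)).symm,
      (botVertex_eq (Fin.succ ⟨t, ht⟩)).symm⟩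

/-- The reachability order of `C m n`. -/
def Below : CycleVertex m n → CycleVertex m n → Prop
  | Sum.inl i, Sum.inl j => (i : ℕ) ≤ j
  | Sum.inl i, Sum.inr _ => (i : ℕ) = 0
  | Sum.inr _, Sum.inl j => (j : ℕ) = m
  | Sum.inr i, Sum.inr j => (i : ℕ) ≤ j

/-- For `m = 0` the two ends would coincide and link any two interior vertices of the other
interval. -/
theorem Below.trans (hm : 1 ≤ m) {x y z : CycleVertex m n} (h : Below x y) (h' : Below y z) :
    Below x z := by
  rcases x with x | x <;> rcases y with y | y <;> rcases z with z | z <;>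
    simp only [Below] at * <;> omega

theorem Below.of_adj {x y : CycleVertex m n} (h : (C m n).Adj x y) : Below x y := by
  rcases adj_iff.1 h with ⟨i, rfl, rfl⟩ | ⟨t, ht, rfl, rfl⟩
  · simp [Below]
  · unfold lowerVertex
    split_ifs <;> simp only [Below, Fin.val_zero, Fin.val_last] <;> first | omega | contradiction

theorem Below.of_reachable (hm : 1 ≤ m) {x y : CycleVertex m n} (h : Reachable (C m n) x y) :
    Below x y := by
  obtain ⟨k, p⟩ := h
  induction p with
  | nil x => rcases x with x | x <;> simp [Below]
  | cons h _ ih => exact (Below.of_adj h).trans hm ih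

theorem hasPath_inl (i j : Fin (m + 1)) (h : i ≤ j) :
    HasPath (C m n) (j - i : ℕ) (Sum.inl i) (Sum.inl j) := by
  obtain ⟨d, hd⟩ : ∃ d, d = (j - i : ℕ) := ⟨_, rfl⟩
  rw [← hd]
  induction d generalizing i with
  | zero =>
    have : i = j := by
      rw [Fin.le_def] at h
      exact Fin.ext (by omega)
    rw [this]
    exact .nil _
  | succ d ih =>
    have hi : (i : ℕ) < m := by omega
    refine .cons (adj_iff.2 (Or.inl ⟨⟨i, hi⟩, rfl, rfl⟩)) (ih _ ?_ ?_)
    · rw [Fin.le_def, Fin.val_succ]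
      change (i : ℕ) + 1 ≤ j
      omega
    · rw [Fin.val_succ]
      change d = (j : ℕ) - (i + 1)
      omega

theorem exists_hasPath_lowerVertex (hn : 1 ≤ n) (i j : ℕ) (h : i ≤ j) :
    ∃ k ≤ j - i, HasPath (C m n) k (lowerVertex m n i) (lowerVertex m n j) := by
  induction j, h using Nat.le_induction with
  | base => exact ⟨0, Nat.zero_le _, .nil _⟩
  | succ j hj ih =>
    obtain ⟨k, hk, p⟩ := ih
    by_cases hn : j < n
    · exact ⟨k + 1, by omega, p.trans (.cons (adj_iff.2 (Or.inr ⟨j, hn, rfl, rfl⟩)) (.nil _))⟩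
    · rcases Nat.eq_zero_or_pos j with rfl | h0
      · omega
      · refine ⟨k, by omega, ?_⟩
        have : lowerVertex m n (j + 1) = lowerVertex m n j := by
          rw [lowerVertex, lowerVertex, dif_neg (by omega), dif_neg (by omega), dif_neg (by omega),
            dif_neg (by omega)]
        rwa [this]

/-- The position of a vertex along the interval of length `n`, extended to a function on all of
`C m n` that increases by at most one along each edge. -/
def lowerPos (m n : ℕ) : CycleVertex m n → ℕ := Sum.elim (fun i => min i n) (fun j => j + 1)

/-- With `n ≤ m` the cutoff `min i n` reaches `n` at the final vertex, so both intervals agree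
there. -/
theorem lowerPos_lowerVertex (hnm : n ≤ m) {t : ℕ} (ht : t ≤ n) :
    lowerPos m n (lowerVertex m n t) = t := by
  unfold lowerVertex
  split_ifs <;> simp [lowerPos] <;> omega

theorem lowerPos_adj (hnm : n ≤ m) (x y : CycleVertex m n) (h : (C m n).Adj x y) :
    lowerPos m n y ≤ lowerPos m n x + 1 := by
  rcases adj_iff.1 h with ⟨i, rfl, rfl⟩ | ⟨t, ht, rfl, rfl⟩
  · simp only [lowerPos, Sum.elim_inl, Fin.val_succ, Fin.val_castSucc]
    omega
  · rw [lowerPos_lowerVertex hnm ht.le, lowerPos_lowerVertex hnm ht]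

/-- The vertices of the interval of length `n` in `C m n`. -/
def lowerSet (m n : ℕ) : Set (CycleVertex m n) :=
  {v | Sum.elim (fun i : Fin (m + 1) => (i : ℕ) = 0 ∨ (i : ℕ) = m) (fun _ => True) v}

theorem inl_mem_lowerSet {i : Fin (m + 1)} :
    (Sum.inl i : CycleVertex m n) ∈ lowerSet m n ↔ (i : ℕ) = 0 ∨ (i : ℕ) = m := Iff.rfl

theorem inr_mem_lowerSet {j : Fin (n - 1)} : (Sum.inr j : CycleVertex m n) ∈ lowerSet m n :=
  trivial

theorem inl_eq_last {i : Fin (m + 1)} :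
    (Sum.inl i : CycleVertex m n) = Sum.inl (Fin.last m) ↔ (i : ℕ) = m := by
  rw [Sum.inl.injEq, Fin.ext_iff, Fin.val_last]

theorem inl_eq_lowerVertex_zero {i : Fin (m + 1)} :
    (Sum.inl i : CycleVertex m n) = lowerVertex m n 0 ↔ (i : ℕ) = 0 := by
  rw [lowerVertex, dif_pos rfl, Sum.inl.injEq, Fin.ext_iff, Fin.val_zero]

/-- The interval of length `n` in `C m n` for `n ≤ m`. -/
def lowerSpine (hn : 1 ≤ n) (hnm : n ≤ m) : Spine (C m n) where
  b := lowerVertex m n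
  pos := lowerPos m n
  mem := lowerSet m n
  top := Sum.inl (Fin.last m)
  b_pos := by
    rintro (i | j) hv
    · rcases inl_mem_lowerSet.1 hv with h | h
      · have : lowerPos m n (Sum.inl i) = 0 := by simp [lowerPos, h]
        rw [this, eq_comm, inl_eq_lowerVertex_zero, h]
      · have : lowerPos m n (Sum.inl i) = n := by simp [lowerPos, h, hnm]
        rw [this, lowerVertex, dif_neg (by omega), dif_neg (by omega), eq_comm, inl_eq_last, h]
    · simp [lowerPos, lowerVertex, show (j : ℕ) + 1 < n by omega]
  b_mem t _ := by
    unfold lowerVertex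
    split_ifs <;> simp [lowerSet]
  pos_b t ht := lowerPos_lowerVertex hnm (by simpa [lowerPos, hnm] using ht)
  b_zero_ne_top h := by
    have := inl_eq_lowerVertex_zero.1 h.symm
    rw [Fin.val_last] at this
    omega
  top_mem := Or.inr rfl
  reachable_b i j h := by
    obtain ⟨k, -, p⟩ := exists_hasPath_lowerVertex hn i j h
    exact ⟨k, p⟩
  dist_b_le i j h := by
    obtain ⟨k, hk, p⟩ := exists_hasPath_lowerVertex hn i j h
    exact p.dist_le.trans (by exact_mod_cast hk)
  le_dist u _ v _ := by
    refine le_iInf₂ fun k p => ?_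
    have := p.le_add (lowerPos_adj hnm)
    exact_mod_cast (by omega)
  pos_lt_pos_top := by
    rintro (i | j) hv ht
    · rw [Ne, inl_eq_last] at ht
      have := (inl_mem_lowerSet.1 hv).resolve_right ht
      simp only [lowerPos, Sum.elim_inl, Fin.val_last]
      omega
    · simp only [lowerPos, Sum.elim_inl, Sum.elim_inr, Fin.val_last]
      omega
  pos_le := by
    rintro (i | i) hu (j | j) hv h <;> have hb := Below.of_reachable (hn.trans hnm) h <;>
      simp only [lowerPos, Sum.elim_inl, Sum.elim_inr, Below] at hb ⊢ <;> omega
  mem_of_reachable := by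
    rintro (i | i) (j | j) hv ht h <;> have hb := Below.of_reachable (hn.trans hnm) h <;>
      simp only [Below] at hb
    · rw [Ne, inl_eq_last] at ht
      rw [inl_mem_lowerSet] at hv ⊢
      omega
    · exact Or.inl hb
    · exact inr_mem_lowerSet
    · exact inr_mem_lowerSet
  eq_of_reachable := by
    rintro (i | i) hu (j | j) hv h <;> have hb := Below.of_reachable (hn.trans hnm) h <;>
      simp only [Below] at hb
    · rw [inl_eq_lowerVertex_zero]
      rw [inl_mem_lowerSet] at hu hv
      omega
    · exact absurd inr_mem_lowerSet hv
    · exact absurd (Or.inr hb) hv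
    · exact absurd inr_mem_lowerSet hv
  top_reachable := by
    rintro (j | j) h <;> have hb := Below.of_reachable (hn.trans hnm) h <;>
      simp only [Below, Fin.val_last] at hb
    · rw [inl_eq_last]
      omega
    · omega

/-- The short edge starts at the initial vertex and ends at the final one, beyond which nothing is
reachable; so it helps only between the two ends. -/
theorem HasPath.le_add_or (hm : 1 ≤ m) {k : ℕ} {x y : CycleVertex m 1}
    (p : HasPath (C m 1) k x y) {i j : Fin (m + 1)} (hx : x = Sum.inl i) (hy : y = Sum.inl j) :
    (j : ℕ) ≤ i + k ∨ (i : ℕ) = 0 ∧ (j : ℕ) = m := by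
  induction p generalizing i with
  | nil x =>
    obtain rfl : i = j := Sum.inl_injective (hx.symm.trans hy)
    exact Or.inl le_rfl
  | @cons k x z y h p ih =>
    rcases adj_iff.1 h with ⟨a, ha, hz⟩ | ⟨t, ht, ha, hz⟩
    · obtain rfl : i = a.castSucc := Sum.inl_injective (hx.symm.trans ha)
      have := ih hz hy
      rw [Fin.val_succ] at this
      rw [Fin.val_castSucc]
      omega
    · obtain rfl : t = 0 := by omega
      have hi := inl_eq_lowerVertex_zero.1 (hx.symm.trans ha)
      have hb := Below.of_reachable hm ⟨_, p⟩
      rw [hz, hy] at hb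
      simp only [lowerVertex, zero_add, one_ne_zero, lt_irrefl, dite_false, Below,
        Fin.val_last] at hb
      have := j.2
      omega

theorem sub_le_dist_C_one (hm : 1 ≤ m) {i j : Fin (m + 1)} (h : ¬ ((i : ℕ) = 0 ∧ (j : ℕ) = m)) :
    ((j - i : ℕ) : ℕ∞) ≤ dist (C m 1) (Sum.inl i) (Sum.inl j) := by
  refine le_iInf₂ fun k p => ?_
  have := (p.le_add_or hm rfl rfl).resolve_right h
  exact_mod_cast (by omega)

/-- The contraction `C m n → C m 1` for `n ≤ m` collapses the interval of length `n`. -/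
def collapseBot (hn : 1 ≤ n) (hnm : n ≤ m) :
    (lowerSpine hn hnm).Collapse (contractBot m n) where
  sec := Sum.elim Sum.inl (fun _ => Sum.inl 0)
  map_sec := by
    rintro (i | j)
    · rfl
    · exact j.elim0
  sec_map := by
    rintro (i | j)
    · change Sum.inl i = (lowerSpine hn hnm).retract (Sum.inl i)
      by_cases h : (Sum.inl i : CycleVertex m n) ∈ (lowerSpine hn hnm).mem
      · by_cases ht : (Sum.inl i : CycleVertex m n) = (lowerSpine hn hnm).top
        · rw [ht, Spine.retract_top]
        · rw [Spine.retract_of_mem h ht]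
          exact inl_eq_lowerVertex_zero.2
            ((inl_mem_lowerSet.1 h).resolve_right fun e => ht (inl_eq_last.2 e))
      · rw [Spine.retract_of_not_mem h]
    · change Sum.inl 0 = (lowerSpine hn hnm).retract (Sum.inr j)
      rw [Spine.retract_of_mem inr_mem_lowerSet Sum.inr_ne_inl]
      rfl
  reachable_sec := by
    rintro (i | i) (j | j) h
    · exact ⟨_, hasPath_inl i j (Below.of_reachable (hn.trans hnm) h)⟩
    · exact j.elim0
    · exact i.elim0
    · exact j.elim0
  dist_sec_le := by
    rintro (i | i) (j | j) h hij
    · refine (hasPath_inl i j (Below.of_reachable (hn.trans hnm) h)).dist_le.trans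
        (sub_le_dist_C_one (hn.trans hnm) fun e => hij ⟨Or.inl e.1, Or.inr e.2⟩)
    · exact j.elim0
    · exact i.elim0
    · exact j.elim0
  le_dist_add_dist := by
    rintro (i | i) (j | j) (k | k) hij hjk hi hj hk
    · have hi' := inl_eq_lowerVertex_zero.1 hi
      have hk' := inl_eq_last.1 hk
      have hj' : ¬ ((j : ℕ) = 0 ∨ (j : ℕ) = m) := hj
      rw [not_or] at hj'
      -- The two distances add up to at least `j + (m - j) = m`, and `n ≤ m`.
      refine le_trans ?_ (add_le_add
        (sub_le_dist_C_one (hn.trans hnm) fun e => hj'.2 e.2)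
        (sub_le_dist_C_one (hn.trans hnm) fun e => hj'.1 e.1))
      have : (lowerSpine hn hnm).pos (lowerSpine hn hnm).top = n := by
        simp [lowerSpine, lowerPos, hnm]
      rw [this]
      exact_mod_cast (by omega)
    all_goals first | exact i.elim0 | exact j.elim0 | exact k.elim0

/-! ### Interchanging the two intervals -/

/-- The isomorphism `C m n → C n m` that interchanges the two intervals. -/
def swap (hm : 1 ≤ m) (hn : 1 ≤ n) : GraphMap (C m n) (C n m) where
  toFun := Sum.elim (fun i => lowerVertex n m i) (fun j => Sum.inl ⟨j + 1, by omega⟩)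
  map_adj := by
    have key : ∀ (t : ℕ) (ht : t ≤ n), Sum.elim (fun i : Fin (m + 1) => lowerVertex n m i)
        (fun j : Fin (n - 1) => Sum.inl ⟨j + 1, by omega⟩) (lowerVertex m n t) =
          Sum.inl ⟨t, by omega⟩ := by
      intro t ht
      rw [lowerVertex]
      split_ifs with h0 h1
      · simp [h0, lowerVertex]
      · exact congrArg Sum.inl (Fin.ext (Nat.sub_add_cancel (by omega)))
      · rw [Sum.elim_inl, lowerVertex, dif_neg (by rw [Fin.val_last]; omega), dif_neg (by simp)]
        congr 1
        exact Fin.ext (by simp; omega)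
    intro x y h
    refine Or.inr (adj_iff.2 ?_)
    rcases adj_iff.1 h with ⟨i, rfl, rfl⟩ | ⟨t, ht, rfl, rfl⟩
    · exact Or.inr ⟨i, i.2, rfl, rfl⟩
    · exact Or.inl ⟨⟨t, ht⟩, key t ht.le, key (t + 1) ht⟩

theorem swap_swap (hm : 1 ≤ m) (hn : 1 ≤ n) (x : CycleVertex m n) :
    (swap hn hm).toFun ((swap hm hn).toFun x) = x := by
  rcases x with i | j
  · change (swap hn hm).toFun (lowerVertex n m i) = _
    unfold lowerVertex
    split_ifs with h0 h1
    · change lowerVertex m n 0 = _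
      rw [eq_comm, inl_eq_lowerVertex_zero, h0]
    · change Sum.inl _ = _
      congr 1
      exact Fin.ext (by simp; omega)
    · change lowerVertex m n n = _
      rw [lowerVertex, dif_neg (by omega), dif_neg (by omega), eq_comm, inl_eq_last]
      omega
  · change lowerVertex m n (j + 1) = _
    rw [lowerVertex, dif_neg (by omega), dif_pos (by omega)]
    simp

theorem contractTop_eq (hm : 1 ≤ m) (hn : 1 ≤ n) (x : CycleVertex m n) :
    (contractTop m n hm).toFun x = (contractBot n m).toFun ((swap hm hn).toFun x) := by
  rcases x with i | j
  · change (if i = Fin.last m then topVertex n 1 (Fin.last n) else topVertex n 1 0) =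
      (contractBot n m).toFun (lowerVertex n m i)
    unfold lowerVertex
    split_ifs with h h0 h1 h2 h3
    · rw [h, Fin.val_last] at h0
      omega
    · rw [h, Fin.val_last] at h1
      omega
    · rfl
    · rfl
    · rfl
    · rw [Fin.ext_iff, Fin.val_last] at h
      omega
  · rfl

end Cycle

/-! ### The two contractions and the dependence on the maximum only -/

section Main

variable {m n : ℕ}

theorem PHmap_contractBot_bijective (hn : 1 ≤ n) (hnm : n ≤ m) (k : ℕ) (l : ℤ) :
    Function.Bijective (PHmap R (contractBot m n) k l) :=
  (collapseBot hn hnm).PHmap_bijective R k l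

theorem PHmap_contractTop_bijective (hm : 1 ≤ m) (hmn : m ≤ n) (k : ℕ) (l : ℤ) :
    Function.Bijective (PHmap R (contractTop m n hm) k l) := by
  have hn : 1 ≤ n := hm.trans hmn
  have e : (PHmap R (contractTop m n hm) k l : PH R (C m n) k l → PH R (C n 1) k l) =
      PHmap R (contractBot n m) k l ∘ PHmap R (swap hm hn) k l :=
    funext (PHmap_PHmap R _ _ _ (contractTop_eq hm hn) k l)
  rw [e]
  exact (PHmap_contractBot_bijective R hm hmn k l).comp
    (PHmap_bijective_of_inverse R (swap hm hn) (swap hn hm) (swap_swap hm hn) (swap_swap hn hm) k l)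

theorem nonempty_PH_equiv (hm : 1 ≤ m) (hn : 1 ≤ n) (k : ℕ) (l : ℤ) :
    Nonempty (PH R (C m n) k l ≃ₗ[R] PH R (C (max m n) 1) k l) := by
  rcases le_total n m with h | h
  · rw [max_eq_left h]
    exact ⟨.ofBijective _ (PHmap_contractBot_bijective R hn h k l)⟩
  · rw [max_eq_right h]
    exact ⟨.ofBijective _ (PHmap_contractTop_bijective R hm h k l)⟩

end Main

end BigradedPath

end

theorem mainTheorem6 (R : Type*) [CommRing R] (m n : ℕ) (hm : 1 ≤ m) (hn : 1 ≤ n) :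
    (∀ m' n' : ℕ, 1 ≤ m' → 1 ≤ n' → max m' n' = max m n → ∀ (k : ℕ) (l : ℤ),
      Nonempty (BigradedPath.PH R (BigradedPath.C m n) k l ≃ₗ[R]
        BigradedPath.PH R (BigradedPath.C m' n') k l)) ∧
    (n ≤ m → ∀ (k : ℕ) (l : ℤ),
      Function.Bijective (BigradedPath.PHmap R (BigradedPath.contractBot m n) k l)) ∧
    (m ≤ n → ∀ (k : ℕ) (l : ℤ),
      Function.Bijective (BigradedPath.PHmap R (BigradedPath.contractTop m n hm) k l)) := by
  refine ⟨fun m' n' hm' hn' h k l => ?_, BigradedPath.PHmap_contractBot_bijective R hn,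
    BigradedPath.PHmap_contractTop_bijective R hm⟩
  obtain ⟨e⟩ := BigradedPath.nonempty_PH_equiv R hm hn k l
  obtain ⟨e'⟩ := BigradedPath.nonempty_PH_equiv R hm' hn' k l
  rw [h] at e'
  exact ⟨e.trans e'.symm⟩
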